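/- Let $n$ particles of mass $1$ on the line, with positions $x_k$ and velocities $y_k$, $1\le k\le n$, move according to the Toda lattice equations $$x_k'=y_k,\qquad y_k'=e^{x_{k-1}-x_k}-e^{x_k-x_{k+1}},\qquad k=1,\dots,n,$$ where by convention $x_0=-\infty$ and $x_{n+1}=+\infty$. Let $(x(0),y(0))$ be initial conditions with $\sum_k x_k(0)=\sum_k y_k(0)=0$. There is exactly one solution with these initial conditions, and it is defined for all $t\in\mathbb R$. There are (necessarily unique) real numbers $c_k^\pm,d_k^\pm$ with $$x_k(t)-(c_k^\pm t+d_k^\pm)\to 0,\qquad y_k(t)\to c_k^\pm\qquad (t\to\pm\infty),$$ and the wave maps are $W^\pm(x(0),y(0))=(c^\pm,d^\pm)$. Let $J$ be the real symmetric tridiagonal matrix with $J_{k,k}=-\tfrac12 y_k(0)$ and $J_{k,k+1}=J_{k+1,k}=\tfrac12\exp\!\big(\tfrac{x_k(0)-x_{k+1}(0)}2\big)$. Its eigenvalues $\lambda_1<\dots<\lambda_n$ are simple. Let $\pi_-$ be the identity permutation of $\{1,\dots,n\}$ and $\pi_+(k)=n+1-k$. For $\pi\in\{\pi_-,\pi_+\}$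 put $\Lambda^\pi=\mathrm{diag}(\lambda_{\pi(1)},\dots,\lambda_{\pi(n)})$. There is a (necessarily unique) orthogonal matrix $Q_\pi$ with $J=Q_\pi^{*}\Lambda^\pi Q_\pi$ and $Q_\pi=L_\pi U_\pi$, where $L_\pi$ is lower triangular with unit diagonal and $U_\pi$ is upper triangular with positive diagonal. The $\pi$-bidiagonal coordinates of $J$ are $\beta^\pi_j=(L_\pi^{-1}\Lambda^\pi L_\pi)_{j+1,j}$, $1\le j\le n-1$. They are positive, and $$c_k^\pm=-2\lambda_{\pi_\pm(k)},\qquad d_k^\pm=\sum_{1\le j<k}\frac{-2j}{n}\log\beta_j^{\pi_\pm}+\sum_{k\le j\le n-1}\frac{2(n-j)}{n}\log\beta_j^{\pi_\pm}+(n-2k+1)\log 2 .$$ Moreover there is a well-defined scattering map $S$ on the image of $W^-$ with $S\circ W^-=W^+$, and it sends $(c^-,d^-)$ to the $(c^+,d^+)$ given by $$c^+_{n+1-k}=c^-_k,\qquad d^+_{n+1-k}=d^-_k+2\sum_{j<k}\log|c_j^--c_k^-|-2\sum_{j>k}\log|c_j^--c_k^-|,\qquad 1\le k\le n .$$ -/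

import Mathlib

open Matrix Filter Topology

/-- Positions and velocities `(x, y)` of `n` particles on the line. -/
abbrev TodaState (n : ℕ) : Type := (Fin n → ℝ) × (Fin n → ℝ)

/-- Initial conditions with zero total position and zero total momentum. -/
abbrev PhaseSpace (n : ℕ) : Type :=
  {p : TodaState n // ∑ k, p.1 k = 0 ∧ ∑ k, p.2 k = 0}

/-- Pairs `(c, d)` of asymptotic velocities and phases. -/
abbrev AsymptoticData (n : ℕ) : Type := (Fin n → ℝ) × (Fin n → ℝ)

/-- The force `exp (x_{k-1} - x_k) - exp (x_k - x_{k+1})` on particle `k`, where a term is absent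
if the neighbour is (this is the convention `x_0 = -∞`, `x_{n+1} = ∞`). -/
noncomputable def todaForce {n : ℕ} (x : Fin n → ℝ) (k : Fin n) : ℝ :=
  (if 0 < (k : ℕ) then Real.exp (x ⟨(k : ℕ) - 1, by omega⟩ - x k) else 0) -
    (if h : (k : ℕ) + 1 < n then Real.exp (x k - x ⟨(k : ℕ) + 1, h⟩) else 0)

/-- `q = (x, y)` solves the Toda equations `x_k' = y_k`, `y_k' = force_k` for all times. -/
def IsTodaTrajectory {n : ℕ} (q : ℝ → TodaState n) : Prop :=
  ∀ (t : ℝ) (k : Fin n),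
    HasDerivAt (fun s => (q s).1 k) ((q t).2 k) t ∧
      HasDerivAt (fun s => (q s).2 k) (todaForce (q t).1 k) t

/-- Along `l` (`atTop` or `atBot`), particle `k` performs asymptotically the uniform motion
`c_k t + d_k`: the difference of the positions tends to `0` and the velocity tends to `c_k`. -/
def HasAsymptotics {n : ℕ} (l : Filter ℝ) (q : ℝ → TodaState n) (a : AsymptoticData n) : Prop :=
  ∀ k : Fin n,
    Tendsto (fun t => (q t).1 k - (a.1 k * t + a.2 k)) l (𝓝 0) ∧
      Tendsto (fun t => (q t).2 k) l (𝓝 (a.1 k))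

/-- `W` is the wave map at `t → +∞` (`l = atTop`) or `t → -∞` (`l = atBot`): it sends initial
conditions to the asymptotic data of the trajectory that starts there at time `0`. -/
def IsWaveMap {n : ℕ} (l : Filter ℝ) (W : PhaseSpace n → AsymptoticData n) : Prop :=
  ∀ (p : PhaseSpace n) (q : ℝ → TodaState n),
    IsTodaTrajectory q → q 0 = p.1 → HasAsymptotics l q (W p)

/-- Flaschka's transformation: the symmetric tridiagonal matrix with `J_{k,k} = -y_k / 2` and
`J_{k,k+1} = J_{k+1,k} = exp ((x_k - x_{k+1}) / 2) / 2`. -/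
noncomputable def flaschka {n : ℕ} (s : TodaState n) : Matrix (Fin n) (Fin n) ℝ :=
  Matrix.of fun i j =>
    if i = j then -(s.2 i) / 2
    else if (i : ℕ) + 1 = j then Real.exp ((s.1 i - s.1 j) / 2) / 2
    else if (j : ℕ) + 1 = i then Real.exp ((s.1 j - s.1 i) / 2) / 2
    else 0

/-- `A` has simple real spectrum `lam 0 < lam 1 < ⋯`. -/
def IsOrderedSpectrum {n : ℕ} (A : Matrix (Fin n) (Fin n) ℝ) (lam : Fin n → ℝ) : Prop :=
  StrictMono lam ∧ A.charpoly = ∏ i, (Polynomial.X - Polynomial.C (lam i))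

/-- `M = L U` with `L` lower unipotent and `U` upper triangular with positive diagonal.
`M` is LU-positive if it has such a factorization. -/
structure IsPositiveLU {n : ℕ} (M L U : Matrix (Fin n) (Fin n) ℝ) : Prop where
  lower : ∀ i j, i < j → L i j = 0
  unipotent : ∀ i, L i i = 1
  upper : ∀ i j, j < i → U i j = 0
  pos : ∀ i, 0 < U i i
  eq_mul : M = L * U

/-- `T = Qᵀ Λ^π Q` with `Q` orthogonal, where `Λ^π = diag (lam (π 1), …, lam (π n))`. -/
def IsDiagonalization {n : ℕ} (T : Matrix (Fin n) (Fin n) ℝ) (lam : Fin n → ℝ)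
    (π : Equiv.Perm (Fin n)) (Q : Matrix (Fin n) (Fin n) ℝ) : Prop :=
  Q ∈ Matrix.orthogonalGroup (Fin n) ℝ ∧ T = Qᵀ * Matrix.diagonal (fun i => lam (π i)) * Q

/-- `β` lists the `π`-bidiagonal coordinates of `T`, a matrix with ordered spectrum `lam`: for the
diagonalization `T = Qᵀ Λ^π Q` with `Q` LU-positive and for the lower unipotent factor `L` of `Q`,
these are the subdiagonal entries of `L⁻¹ Λ^π L`. -/
def IsBidiagonalCoordinates {n : ℕ} (T : Matrix (Fin n) (Fin n) ℝ) (lam : Fin n → ℝ)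
    (π : Equiv.Perm (Fin n)) (β : Fin (n - 1) → ℝ) : Prop :=
  ∃ Q L U : Matrix (Fin n) (Fin n) ℝ,
    IsDiagonalization T lam π Q ∧ IsPositiveLU Q L U ∧
      ∀ i : Fin (n - 1),
        β i = (L⁻¹ * Matrix.diagonal (fun i => lam (π i)) * L)
          ⟨(i : ℕ) + 1, by omega⟩ ⟨(i : ℕ), by omega⟩

/-- The phase of particle `k` (counted from `0`, so that the usual indices are `k + 1` and
`j + 1`) for the bidiagonal coordinates `β`:
`∑_{j < k} (-2 j / n) log β_j + ∑_{j ≥ k} (2 (n - j) / n) log β_j + (n - 2 k + 1) log 2`. -/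
noncomputable def wavePhase {n : ℕ} (β : Fin (n - 1) → ℝ) (k : Fin n) : ℝ :=
  (∑ j : Fin (n - 1) with j.val < k.val,
      -2 * ((j.val : ℝ) + 1) / (n : ℝ) * Real.log (β j)) +
    (∑ j : Fin (n - 1) with k.val ≤ j.val,
      2 * ((n : ℝ) - ((j.val : ℝ) + 1)) / (n : ℝ) * Real.log (β j)) +
    ((n : ℝ) - 2 * ((k.val : ℝ) + 1) + 1) * Real.log 2

/-! In Flaschka's variables the equations of motion become a Lax equation `J' = [A, J]` with `A`
antisymmetric, so the spectrum of `J` is conserved. What moves is the first column of the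
eigenvector matrix `Q`, and its motion is explicit: up to a factor common to all `i`, `Q i 0 ^ 2` is
multiplied by `exp (2 μ_i t)` (`first_component_sq`). For every ordering `μ` of the spectrum there
is an LU-positive `Q` (`exists_isPositiveLU`), and its data are functions of that column. With the
Newton products `N_k(z) = ∏_{j<k} (z - μ_j)` one has `β_0 ⋯ β_{k-1} Q_{00} = N_k(μ_k) Q_{k0}` and
`L_{ik} N_k(μ_k) Q_{k0} = N_k(μ_i) Q_{i0}`. Hence `β_k(t) = exp ((μ_{k+1} - μ_k) t) β_k(0)` exactly,
and `|L_{ik}(t)| = exp ((μ_i - μ_k) t) |L_{ik}(0)|`.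

If the ordering suits the direction of time, the entries of `L` below the diagonal decay, so `L →
1`. Orthogonality of `Q` then forces `U → 1` (`tendsto_upper`). Thus `J → Λ`, which gives the
velocities. The relation `β_k U_{k,k} = J_{k+1,k} U_{k+1,k+1}` turns `U → 1` into `x_k - x_{k+1} = 2
log 2 + 2 log β_k(t) + o(1)`. The gaps are asymptotically affine in `t`, and since the centre of
mass rests at `0` they determine the positions; solving for these gives `wavePhase`.

For scattering, both orderings share the numbers `|Q_{i0}|`. In these terms each phase is `-2 log
|N_k(μ_k) Q_{k0}|`, corrected by a mean over `k` and a multiple of `log 2`. Reversing the ordering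
replaces the product over `j < k` in `N_k` by the one over `j > k`. The components `Q_{i0}` and the
means cancel in the comparison, leaving logarithms of eigenvalue differences, so that `(c⁺, d⁺)`
depends on `(c⁻, d⁻)` alone.

Global existence comes from conservation of energy, which confines trajectories to a region where
the vector field may be replaced by a bounded Lipschitz one. -/

/-! ### Global integral curves and truncated nonlinearities -/

/-- A bounded, globally Lipschitz vector field has global integral curves. -/
theorem LipschitzWith.exists_forall_hasDerivAt {E : Type*} [NormedAddCommGroup E] [NormedSpace ℝ E]
    [CompleteSpace E] {v : E → E} {K M : NNReal} (hv : LipschitzWith K v) (hM : ∀ x, ‖v x‖ ≤ M)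
    (x₀ : E) : ∃ q : ℝ → E, q 0 = x₀ ∧ ∀ t, HasDerivAt q (v (q t)) t := by
  have key : ∀ N : ℕ, ∃ α : ℝ → E, α 0 = x₀ ∧
      ∀ t ∈ Set.Ioo (-((N : ℝ) + 1)) (N + 1), HasDerivAt α (v (α t)) t := by
    intro N
    have h0 : (0 : ℝ) ∈ Set.Icc (-((N : ℝ) + 1)) (N + 1) := by
      constructor <;> nlinarith [Nat.cast_nonneg (α := ℝ) N]
    -- At speed at most `M`, a curve cannot leave the ball of radius `M * (N + 1)` within time `N +
    -- 1`, so the confinement condition of Picard–Lindelöf holds on arbitrarily long intervals.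
    have hp : IsPicardLindelof (fun _ => v) (⟨0, h0⟩ : Set.Icc (-((N : ℝ) + 1)) (N + 1)) x₀
        (M * (N + 1)) 0 M K :=
      { lipschitzOnWith := fun _ _ => hv.lipschitzOnWith
        continuousOn := fun _ _ => continuousOn_const
        norm_le := fun _ _ x _ => hM x
        mul_max_le := by simp }
    obtain ⟨α, hα, h⟩ := hp.exists_eq_forall_mem_Icc_hasDerivWithinAt₀
    exact ⟨α, hα, fun t ht => (h t ⟨ht.1.le, ht.2.le⟩).hasDerivAt (Icc_mem_nhds ht.1 ht.2)⟩
  choose α hα0 hα using key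
  have huniq : ∀ N N' : ℕ, N ≤ N' → ∀ t ∈ Set.Ioo (-((N : ℝ) + 1)) (N + 1), α N t = α N' t := by
    intro N N' hN
    have hN' : (N : ℝ) ≤ N' := by exact_mod_cast hN
    refine ODE_solution_unique_of_mem_Ioo (v := fun _ => v) (s := fun _ => Set.univ) (t₀ := 0)
      (fun _ _ => hv.lipschitzOnWith) ?_ (fun t ht => ⟨hα N t ht, trivial⟩)
      (fun t ht => ⟨hα N' t ⟨by linarith [ht.1], by linarith [ht.2]⟩, trivial⟩) ?_
    · constructor <;> nlinarith [Nat.cast_nonneg (α := ℝ) N]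
    · rw [hα0, hα0]
  -- The solutions on nested intervals are glued. The extra `+ 1` in the interval bounds keeps `t`
  -- in the open interval belonging to `⌈|t|⌉₊`.
  refine ⟨fun t => α ⌈|t|⌉₊ t, by simp [hα0], fun t => ?_⟩
  have ht : t ∈ Set.Ioo (-((⌈|t|⌉₊ : ℝ) + 1)) (⌈|t|⌉₊ + 1) := by
    have := abs_le.1 (Nat.le_ceil |t|)
    constructor <;> linarith [this.1, this.2]
  refine (hα ⌈|t|⌉₊ t ht).congr_of_eventuallyEq ?_
  filter_upwards [Ioo_mem_nhds ht.1 ht.2] with s hs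
  have hs' : s ∈ Set.Ioo (-((⌈|s|⌉₊ : ℝ) + 1)) (⌈|s|⌉₊ + 1) := by
    have := abs_le.1 (Nat.le_ceil |s|)
    constructor <;> linarith [this.1, this.2]
  rcases le_total ⌈|s|⌉₊ ⌈|t|⌉₊ with h | h
  · exact huniq _ _ h s hs'
  · exact (huniq _ _ h s hs).symm

/-- A bounded Lipschitz function that agrees with `exp` up to `C`, with an antiderivative. -/
theorem exists_truncated_exp (C : ℝ) : ∃ (φ V : ℝ → ℝ) (K B : NNReal),
    LipschitzWith K φ ∧ (∀ u, |φ u| ≤ B) ∧ (∀ u, HasDerivAt V (φ u) u) ∧ (∀ u, 0 ≤ V u) ∧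
      (∀ u ≤ C, φ u = Real.exp u ∧ V u = Real.exp u) ∧ ∀ u, C ≤ u → Real.exp C ≤ V u := by
  have hc : Continuous fun u => Real.exp (min u C) := by fun_prop
  have hle : ∀ u ≤ C, Real.exp C + ∫ s in C..u, Real.exp (min s C) = Real.exp u := by
    intro u hu
    have : ∫ s in C..u, Real.exp (min s C) = ∫ s in C..u, Real.exp s := by
      refine intervalIntegral.integral_congr fun s hs => ?_
      rw [Set.uIcc_of_ge hu] at hs
      simp [min_eq_left hs.2]
    rw [this, integral_exp]; ring
  have hge : ∀ u, C ≤ u → Real.exp C ≤ Real.exp C + ∫ s in C..u, Real.exp (min s C) := by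
    intro u hu
    have := intervalIntegral.integral_nonneg (f := fun s => Real.exp (min s C)) (μ := MeasureTheory.volume) hu
      (fun s _ => (Real.exp_pos _).le)
    linarith
  -- The force is frozen at `exp C` beyond `C`. The constant `exp C` in the antiderivative makes it
  -- equal to `exp u`, not just up to a constant, for `u ≤ C`.
  refine ⟨fun u => Real.exp (min u C), fun u => Real.exp C + ∫ s in C..u, Real.exp (min s C),
    ⟨Real.exp C, (Real.exp_pos C).le⟩, ⟨Real.exp C, (Real.exp_pos C).le⟩, ?_, ?_, ?_, ?_, ?_, hge⟩
  · refine LipschitzWith.of_dist_le_mul fun u v => ?_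
    have key : ∀ a b : ℝ, a ≤ b →
        |Real.exp (min a C) - Real.exp (min b C)| ≤ Real.exp C * |a - b| := by
      intro a b hab
      have h1 : min a C ≤ min b C := min_le_min_right C hab
      have h2 : min b C - min a C ≤ b - a := by
        rcases min_cases a C with h | h <;> rcases min_cases b C with h' | h' <;> linarith
      have h3 := Real.add_one_le_exp (min a C - min b C)
      have h4 : Real.exp (min a C) = Real.exp (min b C) * Real.exp (min a C - min b C) := by
        rw [← Real.exp_add]; congr 1; ring
      have h5 : Real.exp (min b C) ≤ Real.exp C := Real.exp_le_exp.2 (min_le_right _ _)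
      have h6 := Real.exp_pos (min b C)
      rw [abs_of_nonpos (sub_nonpos.2 (Real.exp_le_exp.2 h1)), abs_of_nonpos (sub_nonpos.2 hab)]
      nlinarith
    rw [Real.dist_eq, Real.dist_eq]
    rcases le_total u v with h | h
    · exact key u v h
    · rw [abs_sub_comm, abs_sub_comm u]; exact key v u h
  · intro u
    rw [abs_of_pos (Real.exp_pos _)]
    exact Real.exp_le_exp.2 (min_le_right _ _)
  · intro u
    exact ((hc.integral_hasStrictDerivAt C u).hasDerivAt).const_add _
  · intro u
    rcases le_total u C with h | h
    · dsimp only; rw [hle u h]; exact (Real.exp_pos u).le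
    · exact (Real.exp_pos C).le.trans (hge u h)
  · exact fun u hu => ⟨by simp [hu], hle u hu⟩

/-- A bounded Lipschitz function that agrees with the identity on `[-M, M]`, with an
antiderivative. -/
theorem exists_truncated_id {M : ℝ} (hM : 0 ≤ M) : ∃ (κ W : ℝ → ℝ) (B : NNReal),
    LipschitzWith 1 κ ∧ (∀ y, |κ y| ≤ B) ∧ (∀ y, HasDerivAt W (κ y) y) ∧ (∀ y, 0 ≤ W y) ∧
      (∀ y, |y| ≤ M → κ y = y ∧ W y = y ^ 2 / 2) ∧ ∀ y, M ≤ |y| → M ^ 2 / 2 ≤ W y := by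
  set κ : ℝ → ℝ := fun y => max (-M) (min M y) with hκ
  have hL : LipschitzWith 1 κ := (LipschitzWith.id.const_min M).const_max (-M)
  have hc : Continuous κ := hL.continuous
  have hid : ∀ y, |y| ≤ M → κ y = y := by
    intro y hy
    have := abs_le.1 hy
    simp [hκ, this.1, this.2]
  have hodd : ∀ y, κ (-y) = -κ y := by
    intro y
    simp only [hκ]
    rcases min_cases M y with h | h <;> rcases min_cases M (-y) with h' | h' <;>
      rw [h.1, h'.1] <;> grind
  have hnn : ∀ y, 0 ≤ y → 0 ≤ κ y := by
    intro y hy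
    exact le_max_of_le_right (le_min hM hy)
  have heven : ∀ y, ∫ s in (0 : ℝ)..(-y), κ s = ∫ s in (0 : ℝ)..y, κ s := by
    intro y
    have := intervalIntegral.integral_comp_neg (f := κ) (a := 0) (b := y)
    simp only [hodd, intervalIntegral.integral_neg, neg_zero] at this
    rw [intervalIntegral.integral_symm, ← this, neg_neg]
  have hin : ∀ y, |y| ≤ M → ∫ s in (0 : ℝ)..y, κ s = y ^ 2 / 2 := by
    intro y hy
    have : ∫ s in (0 : ℝ)..y, κ s = ∫ s in (0 : ℝ)..y, s := by
      refine intervalIntegral.integral_congr fun s hs => hid s (le_trans ?_ hy)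
      have := Set.abs_sub_left_of_mem_uIcc hs
      simpa using this
    rw [this, integral_id]; ring
  have hpos : ∀ y, 0 ≤ y → 0 ≤ ∫ s in (0 : ℝ)..y, κ s := fun y hy =>
    intervalIntegral.integral_nonneg hy fun s hs => hnn s hs.1
  have hbig : ∀ y, M ≤ y → M ^ 2 / 2 ≤ ∫ s in (0 : ℝ)..y, κ s := by
    intro y hy
    rw [← intervalIntegral.integral_add_adjacent_intervals (b := M)
      (hc.intervalIntegrable _ _) (hc.intervalIntegrable _ _), hin M (abs_of_nonneg hM).le]
    have := intervalIntegral.integral_nonneg (f := κ) (μ := MeasureTheory.volume) hy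
      (fun s hs => hnn s (hM.trans hs.1))
    linarith
  refine ⟨κ, fun y => ∫ s in (0 : ℝ)..y, κ s, ⟨M, hM⟩, hL, fun y => ?_,
    fun y => (hc.integral_hasStrictDerivAt 0 y).hasDerivAt, fun y => ?_,
    fun y hy => ⟨hid y hy, hin y hy⟩, fun y hy => ?_⟩
  · exact abs_le.2 ⟨le_max_left _ _, max_le ((neg_nonpos.2 hM).trans hM)
      (min_le_left _ _)⟩
  · rcases le_total 0 y with h | h
    · exact hpos y h
    · dsimp only; rw [← heven]; exact hpos _ (neg_nonneg.2 h)
  · rcases le_total 0 y with h | h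
    · rw [abs_of_nonneg h] at hy; exact hbig y hy
    · rw [abs_of_nonpos h] at hy; dsimp only; rw [← heven]; exact hbig _ hy

/-! ### Chains with general kinetic and interaction functions -/

/-- The nearest-neighbour force of a chain with interaction force `φ`. -/
noncomputable def chainForce {n : ℕ} (φ : ℝ → ℝ) (x : Fin n → ℝ) (k : Fin n) : ℝ :=
  (if 0 < (k : ℕ) then φ (x ⟨(k : ℕ) - 1, by omega⟩ - x k) else 0) -
    (if h : (k : ℕ) + 1 < n then φ (x k - x ⟨(k : ℕ) + 1, h⟩) else 0)

/-- Trajectories of the chain with kinetic velocity function `κ` and interaction force `φ`. -/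
def IsChainTrajectory {n : ℕ} (κ φ : ℝ → ℝ) (q : ℝ → TodaState n) : Prop :=
  ∀ (t : ℝ) (k : Fin n),
    HasDerivAt (fun s => (q s).1 k) (κ ((q t).2 k)) t ∧
      HasDerivAt (fun s => (q s).2 k) (chainForce φ (q t).1 k) t

/-- The energy of a chain with kinetic energy `W` and interaction potential `V`. -/
noncomputable def chainEnergy {n : ℕ} (W V : ℝ → ℝ) (s : TodaState n) : ℝ :=
  ∑ k, W (s.2 k) + ∑ k : Fin n, if h : (k : ℕ) + 1 < n then V (s.1 k - s.1 ⟨(k : ℕ) + 1, h⟩) else 0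

/-- Summation by parts: each bond acts on its two ends with opposite signs. Taking for `z` the
velocities gives conservation of energy, and `z = 1` gives conservation of momentum. -/
theorem sum_mul_chainForce {n : ℕ} (φ : ℝ → ℝ) (x z : Fin n → ℝ) :
    ∑ k, z k * chainForce φ x k = -∑ k : Fin n, if h : (k : ℕ) + 1 < n then
      φ (x k - x ⟨(k : ℕ) + 1, h⟩) * (z k - z ⟨(k : ℕ) + 1, h⟩) else 0 := by
  rcases n with _ | m
  · simp
  simp only [chainForce, mul_sub, Finset.sum_sub_distrib]
  rw [Fin.sum_univ_succ (f := fun k : Fin (m + 1) => z k * ite _ _ _),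
    Fin.sum_univ_castSucc (f := fun k : Fin (m + 1) => z k * dite _ _ _),
    Fin.sum_univ_castSucc (f := fun k : Fin (m + 1) => dite _ _ _)]
  simp only [Fin.val_zero, lt_self_iff_false, if_false, mul_zero, zero_add, Fin.val_succ,
    Fin.val_last, dite_false, add_zero, Fin.val_castSucc]
  rw [← Finset.sum_sub_distrib, ← Finset.sum_neg_distrib]
  refine Finset.sum_congr rfl fun i _ => ?_
  have h1 : (i : ℕ) + 1 < m + 1 := by omega
  have e1 : (⟨(i : ℕ) + 1 - 1, by omega⟩ : Fin (m + 1)) = i.castSucc := by ext; simp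
  have e2 : (⟨(i : ℕ) + 1, h1⟩ : Fin (m + 1)) = i.succ := rfl
  simp only [h1, dite_true, Nat.succ_pos, if_true, e1, e2]
  ring

theorem sum_chainForce {n : ℕ} (φ : ℝ → ℝ) (x : Fin n → ℝ) : ∑ k, chainForce φ x k = 0 := by
  simpa using sum_mul_chainForce φ x fun _ => 1

theorem eq_of_forall_hasDerivAt_zero {f : ℝ → ℝ} (h : ∀ t, HasDerivAt f 0 t) (s t : ℝ) :
    f s = f t :=
  is_const_of_deriv_eq_zero (fun t => (h t).differentiableAt) (fun t => (h t).deriv) s t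

theorem IsChainTrajectory.chainEnergy_eq {n : ℕ} {κ φ W V : ℝ → ℝ} {q : ℝ → TodaState n}
    (hq : IsChainTrajectory κ φ q) (hW : ∀ y, HasDerivAt W (κ y) y)
    (hV : ∀ u, HasDerivAt V (φ u) u) (t : ℝ) :
    chainEnergy W V (q t) = chainEnergy W V (q 0) := by
  refine eq_of_forall_hasDerivAt_zero (f := fun t => chainEnergy W V (q t)) (fun t => ?_) t 0
  have h1 : HasDerivAt (fun s => ∑ k, W ((q s).2 k))
      (∑ k, κ ((q t).2 k) * chainForce φ (q t).1 k) t :=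
    HasDerivAt.fun_sum fun k _ => (hW _).comp t (hq t k).2
  have h2 : HasDerivAt (fun s => ∑ k : Fin n, if h : (k : ℕ) + 1 < n then
        V ((q s).1 k - (q s).1 ⟨(k : ℕ) + 1, h⟩) else 0)
      (∑ k : Fin n, if h : (k : ℕ) + 1 < n then
        φ ((q t).1 k - (q t).1 ⟨(k : ℕ) + 1, h⟩) *
          (κ ((q t).2 k) - κ ((q t).2 ⟨(k : ℕ) + 1, h⟩)) else 0) t := by
    refine HasDerivAt.fun_sum fun k _ => ?_
    by_cases h : (k : ℕ) + 1 < n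
    · simp only [h, dite_true]
      exact (hV _).comp t ((hq t k).1.sub (hq t ⟨(k : ℕ) + 1, h⟩).1)
    · simp only [h, dite_false]
      exact hasDerivAt_const _ _
  have h3 := h1.add h2
  rw [sum_mul_chainForce, neg_add_cancel] at h3
  exact h3

theorem LipschitzWith.apply_sub_apply {n : ℕ} {K : NNReal} {φ : ℝ → ℝ} (h : LipschitzWith K φ)
    (i j : Fin n) : LipschitzWith (K * 2) fun x : Fin n → ℝ => φ (x i - x j) := by
  refine h.comp ?_
  have := (LipschitzWith.eval (α := fun _ : Fin n => ℝ) i).sub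
    (LipschitzWith.eval (α := fun _ : Fin n => ℝ) j)
  rwa [one_add_one_eq_two] at this

theorem LipschitzWith.chainForce {n : ℕ} {K : NNReal} {φ : ℝ → ℝ} (h : LipschitzWith K φ)
    (k : Fin n) : LipschitzWith (K * 2 + K * 2) fun x : Fin n → ℝ => chainForce φ x k := by
  unfold _root_.chainForce
  refine LipschitzWith.sub ?_ ?_
  · split_ifs
    · exact h.apply_sub_apply _ _
    · exact (LipschitzWith.const 0).weaken bot_le
  · split_ifs
    · exact h.apply_sub_apply _ _
    · exact (LipschitzWith.const 0).weaken bot_le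

/-- The vector field of a chain. -/
noncomputable def chainField {n : ℕ} (κ φ : ℝ → ℝ) (s : TodaState n) : TodaState n :=
  (fun k => κ (s.2 k), fun k => chainForce φ s.1 k)

theorem isChainTrajectory_iff {n : ℕ} {κ φ : ℝ → ℝ} {q : ℝ → TodaState n} :
    IsChainTrajectory κ φ q ↔ ∀ t, HasDerivAt q (chainField κ φ (q t)) t := by
  constructor
  · intro h t
    have h1 : HasDerivAt (fun s => (q s).1) (fun k => κ ((q t).2 k)) t :=
      hasDerivAt_pi.2 fun k => (h t k).1
    have h2 : HasDerivAt (fun s => (q s).2) (fun k => chainForce φ (q t).1 k) t :=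
      hasDerivAt_pi.2 fun k => (h t k).2
    exact h1.prodMk h2
  · intro h t k
    exact ⟨hasDerivAt_pi.1 (h t).fst k, hasDerivAt_pi.1 (h t).snd k⟩

theorem LipschitzWith.chainField {n : ℕ} {K K' : NNReal} {κ φ : ℝ → ℝ} (hκ : LipschitzWith K' κ)
    (hφ : LipschitzWith K φ) :
    LipschitzWith (max (K' * 1) ((K * 2 + K * 2) * 1)) (chainField (n := n) κ φ) := by
  refine LipschitzWith.prodMk ?_ ?_
  · refine LipschitzWith.comp (f := fun y : Fin n → ℝ => fun k => κ (y k)) ?_ LipschitzWith.prod_snd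
    refine LipschitzWith.of_dist_le_mul fun y y' => (dist_pi_le_iff (by positivity)).2 fun k => ?_
    exact (hκ.dist_le_mul _ _).trans (by gcongr; exact dist_le_pi_dist y y' k)
  · refine LipschitzWith.comp (f := fun x : Fin n → ℝ => fun k => _root_.chainForce φ x k) ?_
      LipschitzWith.prod_fst
    exact LipschitzWith.of_dist_le_mul fun y y' => (dist_pi_le_iff (by positivity)).2 fun k =>
      (hφ.chainForce k).dist_le_mul y y'

theorem norm_chainField_le {n : ℕ} {B B' : NNReal} {κ φ : ℝ → ℝ} (hκ : ∀ y, |κ y| ≤ B')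
    (hφ : ∀ u, |φ u| ≤ B) (s : TodaState n) : ‖chainField κ φ s‖ ≤ (max B' (B + B) : NNReal) := by
  rw [NNReal.coe_max]
  refine max_le_max ((pi_norm_le_iff_of_nonneg B'.2).2 fun k => hκ _)
    ((pi_norm_le_iff_of_nonneg (B + B).2).2 fun k => ?_)
  change |chainForce φ s.1 k| ≤ _
  unfold chainForce
  refine (abs_sub _ _).trans (add_le_add ?_ ?_)
  · split_ifs
    · exact hφ _
    · simp
  · split_ifs
    · exact hφ _
    · simp

theorem isTodaTrajectory_iff {n : ℕ} {q : ℝ → TodaState n} :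
    IsTodaTrajectory q ↔ IsChainTrajectory id Real.exp q := Iff.rfl

theorem kinetic_le_chainEnergy {n : ℕ} {W V : ℝ → ℝ} (hW : ∀ y, 0 ≤ W y) (hV : ∀ u, 0 ≤ V u)
    (s : TodaState n) (k : Fin n) : W (s.2 k) ≤ chainEnergy W V s := by
  have h1 : W (s.2 k) ≤ ∑ k, W (s.2 k) :=
    Finset.single_le_sum (f := fun k => W (s.2 k)) (fun k _ => hW _) (Finset.mem_univ k)
  refine h1.trans (le_add_of_nonneg_right (Finset.sum_nonneg fun k _ => ?_))
  split_ifs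
  · exact hV _
  · rfl

theorem potential_le_chainEnergy {n : ℕ} {W V : ℝ → ℝ} (hW : ∀ y, 0 ≤ W y) (hV : ∀ u, 0 ≤ V u)
    (s : TodaState n) (k : Fin n) (h : (k : ℕ) + 1 < n) :
    V (s.1 k - s.1 ⟨(k : ℕ) + 1, h⟩) ≤ chainEnergy W V s := by
  have h1 := Finset.single_le_sum (f := fun k : Fin n => if h : (k : ℕ) + 1 < n then
    V (s.1 k - s.1 ⟨(k : ℕ) + 1, h⟩) else 0) (fun k _ => by
      split_ifs; exacts [hV _, le_rfl]) (Finset.mem_univ k)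
  simp only [h, dite_true] at h1
  exact h1.trans (le_add_of_nonneg_left (Finset.sum_nonneg fun k _ => hW _))

/-- Two chain fields agree at a state whose velocities and stretches lie where the functions
agree. -/
theorem chainField_congr {n : ℕ} {κ κ' φ φ' : ℝ → ℝ} {s : TodaState n}
    (hκ : ∀ k, κ (s.2 k) = κ' (s.2 k))
    (hφ : ∀ (k : Fin n) (h : (k : ℕ) + 1 < n), φ (s.1 k - s.1 ⟨(k : ℕ) + 1, h⟩) =
      φ' (s.1 k - s.1 ⟨(k : ℕ) + 1, h⟩)) : chainField κ φ s = chainField κ' φ' s := by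
  refine Prod.ext (funext hκ) (funext fun k => ?_)
  simp only [chainField, chainForce]
  congr 1
  · split_ifs with hk
    · have := hφ ⟨(k : ℕ) - 1, by omega⟩ (by simp only; omega)
      have e : (⟨(k : ℕ) - 1 + 1, by omega⟩ : Fin n) = k := Fin.ext (by simp only; omega)
      simp only [e] at this
      exact this
    · rfl
  · split_ifs with hk
    · exact hφ k hk
    · rfl

/-- Energy bounds every velocity and every stretch `x_k - x_{k+1}` from above, so a Toda trajectory
also solves the system with truncated functions, which yields uniqueness. Conversely the truncated
system conserves its own energy, which exceeds the initial value wherever the truncation is felt.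
Its global solution therefore never gets there and solves the Toda equations. -/
theorem existsUnique_isTodaTrajectory {n : ℕ} (s : TodaState n) :
    ∃! q : ℝ → TodaState n, IsTodaTrajectory q ∧ q 0 = s := by
  set E := chainEnergy (fun y => y ^ 2 / 2) Real.exp s with hE
  have hE0 : 0 ≤ E := add_nonneg (Finset.sum_nonneg fun k _ => by positivity)
    (Finset.sum_nonneg fun k _ => by split_ifs <;> positivity)
  have hsq : ∀ y, HasDerivAt (fun y : ℝ => y ^ 2 / 2) (id y) y := fun y => by
    simpa using (hasDerivAt_pow 2 y).div_const 2
  have hsq0 : ∀ y : ℝ, 0 ≤ y ^ 2 / 2 := fun y => by positivity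
  -- The thresholds are chosen so that reaching either costs more than the available energy: `M ^ 2
  -- / 2 > E` and, below, `exp C = E + 1 > E`.
  set M := 2 * E + 1 with hMdef
  have hM : 0 ≤ M := by positivity
  have hME : E < M ^ 2 / 2 := by nlinarith
  set C := Real.log (E + 1) with hC
  have hCE : Real.exp C = E + 1 := Real.exp_log (by linarith)
  obtain ⟨φ, V, K, B, hφL, hφB, hV, hV0, hVin, hVout⟩ := exists_truncated_exp C
  obtain ⟨κ, W, B', hκL, hκB, hW, hW0, hWin, hWout⟩ := exists_truncated_id hM
  have hlip := hκL.chainField (n := n) hφL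
  have hy0 : ∀ s' : TodaState n, chainEnergy (fun y => y ^ 2 / 2) Real.exp s' = E →
      ∀ k, |s'.2 k| ≤ M := by
    intro s' h k
    have h1 := kinetic_le_chainEnergy hsq0 (fun u => (Real.exp_pos u).le) s' k
    rw [h] at h1
    exact abs_le_of_sq_le_sq (by linarith) hM
  have hu0 : ∀ s' : TodaState n, chainEnergy (fun y => y ^ 2 / 2) Real.exp s' = E →
      ∀ (k : Fin n) (h : (k : ℕ) + 1 < n), s'.1 k - s'.1 ⟨(k : ℕ) + 1, h⟩ ≤ C := by
    intro s' h k hk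
    have h1 := potential_le_chainEnergy hsq0 (fun u => (Real.exp_pos u).le) s' k hk
    rw [h] at h1
    rw [← Real.exp_le_exp, hCE]; linarith
  have hEs : chainEnergy W V s = E := by
    rw [hE]
    unfold chainEnergy
    congr 1
    · exact Finset.sum_congr rfl fun k _ => (hWin _ (hy0 s rfl k)).2
    · refine Finset.sum_congr rfl fun k _ => ?_
      split_ifs with hk
      · exact (hVin _ (hu0 s rfl k hk)).2
      · rfl
  have toTrunc : ∀ q : ℝ → TodaState n, IsTodaTrajectory q → q 0 = s →
      ∀ t, HasDerivAt q (chainField κ φ (q t)) t := by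
    intro q hq h0 t
    have hEt : chainEnergy (fun y => y ^ 2 / 2) Real.exp (q t) = E := by
      rw [(isTodaTrajectory_iff.1 hq).chainEnergy_eq hsq Real.hasDerivAt_exp, h0]
    rw [chainField_congr (κ' := id) (φ' := Real.exp) (fun k => (hWin _ (hy0 _ hEt k)).1)
      (fun k h => (hVin _ (hu0 _ hEt k h)).1)]
    exact isChainTrajectory_iff.1 (isTodaTrajectory_iff.1 hq) t
  obtain ⟨q, hq0, hq⟩ := hlip.exists_forall_hasDerivAt (norm_chainField_le hκB hφB) s
  refine ⟨q, ⟨?_, hq0⟩, fun q' hq' => ?_⟩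
  · refine isTodaTrajectory_iff.2 (isChainTrajectory_iff.2 fun t => ?_)
    have hEt : chainEnergy W V (q t) = E := by
      rw [(isChainTrajectory_iff.2 hq).chainEnergy_eq hW hV, hq0, hEs]
    have hy : ∀ k, |(q t).2 k| ≤ M := by
      intro k
      by_contra! h
      have := kinetic_le_chainEnergy hW0 hV0 (q t) k
      linarith [hWout _ h.le]
    have hu : ∀ (k : Fin n) (h : (k : ℕ) + 1 < n),
        (q t).1 k - (q t).1 ⟨(k : ℕ) + 1, h⟩ ≤ C := by
      intro k hk
      by_contra! h
      have := potential_le_chainEnergy hW0 hV0 (q t) k hk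
      linarith [hVout _ h.le]
    rw [← chainField_congr (κ := κ) (φ := φ) (fun k => (hWin _ (hy k)).1)
      (fun k h => (hVin _ (hu k h)).1)]
    exact hq t
  · exact ODE_solution_unique_univ (v := fun _ => chainField κ φ) (s := fun _ => Set.univ)
      (t₀ := 0) (fun _ => hlip.lipschitzOnWith) (fun t => ⟨toTrunc q' hq'.1 hq'.2 t, trivial⟩)
      (fun t => ⟨hq t, trivial⟩) (hq'.2.trans hq0.symm)

/-! ### Jacobi matrices and their LU-positive diagonalizations -/

/-- Jacobi matrices: symmetric tridiagonal with positive off-diagonal entries. -/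
structure IsJacobi {m : ℕ} (J : Matrix (Fin (m + 1)) (Fin (m + 1)) ℝ) : Prop where
  symm : ∀ i j, J i j = J j i
  pos : ∀ k : Fin m, 0 < J k.succ k.castSucc
  tridiag : ∀ i j : Fin (m + 1), (j : ℕ) + 1 < i → J i j = 0

theorem isJacobi_flaschka {m : ℕ} (s : TodaState (m + 1)) : IsJacobi (flaschka s) where
  symm i j := by
    simp only [flaschka, of_apply]
    rcases lt_trichotomy i j with h | rfl | h
    · have h' : (i : ℕ) < j := h
      simp [h.ne, h.ne', show ¬ ((j : ℕ) + 1 = i) by omega]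
    · rfl
    · have h' : (j : ℕ) < i := h
      simp [h.ne, h.ne', show ¬ ((i : ℕ) + 1 = j) by omega]
  pos k := by
    have h1 : k.succ ≠ k.castSucc := Fin.castSucc_lt_succ.ne'
    simp only [flaschka, of_apply, h1, if_false, Fin.val_succ, Fin.val_castSucc, if_true]
    split_ifs <;> positivity
  tridiag i j h := by
    have h1 : i ≠ j := by rintro rfl; omega
    simp [flaschka, h1, show ¬ ((i : ℕ) + 1 = j) by omega, show ¬ ((j : ℕ) + 1 = i) by omega]

theorem flaschka_succ_castSucc {m : ℕ} (s : TodaState (m + 1)) (k : Fin m) :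
    flaschka s k.succ k.castSucc = Real.exp ((s.1 k.castSucc - s.1 k.succ) / 2) / 2 := by
  have h1 : k.succ ≠ k.castSucc := Fin.castSucc_lt_succ.ne'
  simp [flaschka, h1]
  omega

theorem flaschka_self {n : ℕ} (s : TodaState n) (k : Fin n) : flaschka s k k = -(s.2 k) / 2 := by
  simp [flaschka]

namespace IsJacobi

variable {m : ℕ} {J : Matrix (Fin (m + 1)) (Fin (m + 1)) ℝ}

theorem transpose_eq (hJ : IsJacobi J) : Jᵀ = J := by
  ext i j; exact hJ.symm j i

theorem apply_eq_zero (hJ : IsJacobi J) {i j : Fin (m + 1)} (h : (i : ℕ) + 1 < j) : J i j = 0 := by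
  rw [hJ.symm]; exact hJ.tridiag _ _ h

/-- Row `k` of the eigenvector equation expresses `v (k + 1)` through earlier components, because
the off-diagonal entry is nonzero. This is the source both of simple spectrum and of nonvanishing
first components of eigenvectors. -/
theorem eigenvector_eq_zero (hJ : IsJacobi J) {z : ℝ} {v : Fin (m + 1) → ℝ} (hv : J *ᵥ v = z • v)
    (h0 : v 0 = 0) : v = 0 := by
  have key : ∀ k : Fin (m + 1), ∀ j ≤ k, v j = 0 := by
    intro k
    induction k using Fin.induction with
    | zero => intro j hj; rw [Fin.le_zero_iff.1 hj, h0]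
    | succ k ih =>
      intro j hj
      rcases hj.lt_or_eq with h | rfl
      · exact ih j (Fin.le_castSucc_iff.2 h)
      · have h1 := congrFun hv k.castSucc
        rw [Pi.smul_apply, ih _ le_rfl, smul_zero, mulVec, dotProduct,
          Finset.sum_eq_single k.succ] at h1
        · rw [hJ.symm] at h1
          exact (mul_eq_zero.1 h1).resolve_left (hJ.pos k).ne'
        · intro j _ hj
          rcases lt_or_gt_of_ne hj with h | h
          · rw [ih j (Fin.le_castSucc_iff.2 h), mul_zero]
          · rw [hJ.apply_eq_zero, zero_mul]
            simpa [Fin.lt_def] using h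
        · simp
  exact funext fun k => key k k le_rfl

end IsJacobi

/-- The Newton polynomial `∏_{j < k} (z - μ_j)`. -/
def newtonProd {m : ℕ} (μ : Fin (m + 1) → ℝ) (k : Fin (m + 1)) (z : ℝ) : ℝ :=
  ∏ j ∈ Finset.Iio k, (z - μ j)

theorem newtonProd_zero {m : ℕ} (μ : Fin (m + 1) → ℝ) (z : ℝ) : newtonProd μ 0 z = 1 := by
  exact Finset.prod_eq_one fun j hj => absurd (Finset.mem_Iio.1 hj) (Fin.not_lt_zero j)

theorem Fin.Iio_succ_eq_insert {m : ℕ} (k : Fin m) :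
    Finset.Iio k.succ = insert k.castSucc (Finset.Iio k.castSucc) := by
  ext j
  simp only [Finset.mem_Iio, Finset.mem_insert, Fin.lt_def, Fin.ext_iff, Fin.val_succ,
    Fin.val_castSucc]
  omega

theorem newtonProd_succ {m : ℕ} (μ : Fin (m + 1) → ℝ) (k : Fin m) (z : ℝ) :
    newtonProd μ k.succ z = (z - μ k.castSucc) * newtonProd μ k.castSucc z := by
  rw [newtonProd, Fin.Iio_succ_eq_insert, Finset.prod_insert (by simp)]
  rfl

theorem newtonProd_eq_zero {m : ℕ} (μ : Fin (m + 1) → ℝ) {i k : Fin (m + 1)} (h : i < k) :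
    newtonProd μ k (μ i) = 0 :=
  Finset.prod_eq_zero (Finset.mem_Iio.2 h) (sub_self _)

theorem newtonProd_self_ne_zero {m : ℕ} {μ : Fin (m + 1) → ℝ} (hμ : Function.Injective μ)
    (k : Fin (m + 1)) : newtonProd μ k (μ k) ≠ 0 :=
  Finset.prod_ne_zero_iff.2 fun _ hj =>
    sub_ne_zero.2 fun h => (Finset.mem_Iio.1 hj).ne' (hμ h)

/-- A lower unipotent matrix has determinant one. -/
theorem det_eq_one_of_lower_unipotent {n : ℕ} {L : Matrix (Fin n) (Fin n) ℝ}
    (h : ∀ i j, i < j → L i j = 0) (h' : ∀ i, L i i = 1) : L.det = 1 := by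
  rw [det_of_isLowerTriangular L fun i j hij => h i j (OrderDual.toDual_lt_toDual.1 hij)]
  simp [h']

theorem exists_unit_eigenvector {n : ℕ} {J : Matrix (Fin n) (Fin n) ℝ} {μ : Fin n → ℝ}
    (hμ : J.charpoly = ∏ i, (Polynomial.X - Polynomial.C (μ i))) (i : Fin n) :
    ∃ v : Fin n → ℝ, v ⬝ᵥ v = 1 ∧ J *ᵥ v = μ i • v := by
  have h : (J.charpoly).eval (μ i) = 0 := by
    rw [hμ, Polynomial.eval_prod]
    exact Finset.prod_eq_zero (Finset.mem_univ i) (by simp)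
  rw [Matrix.eval_charpoly] at h
  obtain ⟨v, hv0, hv⟩ := Matrix.exists_mulVec_eq_zero_iff.2 h
  rw [sub_mulVec, sub_eq_zero] at hv
  have hv' : J *ᵥ v = μ i • v := by
    rw [← hv]; ext; simp [Matrix.scalar_apply, mulVec_diagonal]
  have hpos : 0 < v ⬝ᵥ v := by
    refine lt_of_le_of_ne (Finset.sum_nonneg fun k _ => mul_self_nonneg _) fun h0 => hv0 ?_
    exact dotProduct_self_eq_zero.1 h0.symm
  refine ⟨(Real.sqrt (v ⬝ᵥ v))⁻¹ • v, ?_, ?_⟩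
  · rw [smul_dotProduct, dotProduct_smul, smul_eq_mul, smul_eq_mul, ← mul_assoc, ← mul_inv,
      Real.mul_self_sqrt hpos.le, inv_mul_cancel₀ hpos.ne']
  · rw [mulVec_smul, hv', smul_comm]

theorem dotProduct_eigenvectors_eq_zero {n : ℕ} {J : Matrix (Fin n) (Fin n) ℝ} (hJ : Jᵀ = J)
    {a b : ℝ} (hab : a ≠ b) {v w : Fin n → ℝ} (hv : J *ᵥ v = a • v) (hw : J *ᵥ w = b • w) :
    v ⬝ᵥ w = 0 := by
  have h1 : (J *ᵥ v) ⬝ᵥ w = v ⬝ᵥ (J *ᵥ w) := by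
    rw [dotProduct_mulVec, ← mulVec_transpose, hJ]
  rw [hv, hw, smul_dotProduct, dotProduct_smul, smul_eq_mul, smul_eq_mul] at h1
  have : (a - b) * (v ⬝ᵥ w) = 0 := by linear_combination h1
  exact (mul_eq_zero.1 this).resolve_left (sub_ne_zero.2 hab)

namespace IsJacobi

variable {m : ℕ} {J : Matrix (Fin (m + 1)) (Fin (m + 1)) ℝ}

/-- Each unit eigenvector is free up to sign and its first component is nonzero, so the signs of the
first column of `Q` can be prescribed through `s`. -/
theorem exists_orthonormal_eigenvectors (hJ : IsJacobi J) {μ : Fin (m + 1) → ℝ}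
    (hinj : Function.Injective μ)
    (hμ : J.charpoly = ∏ i, (Polynomial.X - Polynomial.C (μ i))) {s : Fin (m + 1) → ℝ}
    (hs : ∀ i, s i ≠ 0) :
    ∃ Q : Matrix (Fin (m + 1)) (Fin (m + 1)) ℝ, Q * Qᵀ = 1 ∧ J = Qᵀ * diagonal μ * Q ∧
      ∀ i, 0 < Q i 0 * s i := by
  have key : ∀ i, ∃ v : Fin (m + 1) → ℝ, v ⬝ᵥ v = 1 ∧ J *ᵥ v = μ i • v ∧ 0 < v 0 * s i := by
    intro i
    obtain ⟨v, hv1, hv⟩ := exists_unit_eigenvector hμ i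
    have h0 : v 0 ≠ 0 := fun h0 => by
      rw [hJ.eigenvector_eq_zero hv h0] at hv1
      simp at hv1
    rcases lt_or_gt_of_ne (mul_ne_zero h0 (hs i)) with h | h
    · exact ⟨-v, by simpa using hv1, by rw [mulVec_neg, hv, smul_neg], by simpa using h⟩
    · exact ⟨v, hv1, hv, h⟩
  choose v hv1 hv hpos using key
  have hQ : (of v) * (of v)ᵀ = 1 := by
    ext i j
    have : ((of v) * (of v)ᵀ) i j = v i ⬝ᵥ v j := rfl
    rw [this, one_apply]
    split_ifs with h
    · rw [h, hv1]
    · exact dotProduct_eigenvectors_eq_zero hJ.transpose_eq (hinj.ne h) (hv i) (hv j)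
  have hJQ : J * (of v)ᵀ = (of v)ᵀ * diagonal μ := by
    ext i j
    have := congrFun (hv j) i
    simp only [Pi.smul_apply, smul_eq_mul] at this
    rw [mul_diagonal, transpose_apply, of_apply, mul_comm, ← this]
    rfl
  refine ⟨of v, hQ, ?_, hpos⟩
  rw [← hJQ, Matrix.mul_assoc, mul_eq_one_comm.1 hQ, Matrix.mul_one]

/-- Existence of the LU-positive diagonalization for any ordering `μ` of the spectrum. -/
theorem exists_isPositiveLU (hJ : IsJacobi J) {μ : Fin (m + 1) → ℝ}
    (hinj : Function.Injective μ)
    (hμ : J.charpoly = ∏ i, (Polynomial.X - Polynomial.C (μ i))) :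
    ∃ Q L U : Matrix (Fin (m + 1)) (Fin (m + 1)) ℝ, Q * Qᵀ = 1 ∧ J = Qᵀ * diagonal μ * Q ∧
      IsPositiveLU Q L U := by
  -- An LU-positive `Q` must satisfy `N_k(μ_k) Q_{k0} = β_0 ⋯ β_{k-1} Q_{00} > 0`, which dictates
  -- this choice of signs.
  obtain ⟨Q, hQ, hJQ, hpos⟩ := hJ.exists_orthonormal_eigenvectors hinj hμ
    (newtonProd_self_ne_zero hinj)
  set g : Fin (m + 1) → ℝ := fun i => Q i 0 * newtonProd μ i (μ i) with hg
  have hg0 : ∀ i, g i ≠ 0 := fun i => (hpos i).ne'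
  -- The columns of `L` are the Newton products applied to the first column of `Q`, scaled to have
  -- unit diagonal. Since `N_{k+1}(z) = (z - μ_k) N_k(z)`, multiplication by `Λ` acts on them
  -- through the bidiagonal matrix `B`.
  set L : Matrix (Fin (m + 1)) (Fin (m + 1)) ℝ :=
    of fun i k => Q i 0 * newtonProd μ k (μ i) / g k with hL
  set B : Matrix (Fin (m + 1)) (Fin (m + 1)) ℝ := of fun i k =>
    (if i = k then μ k else 0) + (if (k : ℕ) + 1 = i then g i / g k else 0) with hB
  have hlow : ∀ i k, i < k → L i k = 0 := fun i k h => by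
    simp [hL, newtonProd_eq_zero μ h]
  have hone : ∀ i, L i i = 1 := fun i => div_self (hg0 i)
  have hdet : IsUnit L.det := by rw [det_eq_one_of_lower_unipotent hlow hone]; exact isUnit_one
  have hLB : diagonal μ * L = L * B := by
    ext i k
    rw [diagonal_mul, mul_apply]
    simp only [hB, of_apply, mul_add, Finset.sum_add_distrib, mul_ite, mul_zero,
      Finset.sum_ite_eq', Finset.mem_univ, if_true]
    rcases Fin.eq_castSucc_or_eq_last k with ⟨k, rfl⟩ | rfl
    · rw [Finset.sum_eq_single k.succ]
      · simp only [Fin.val_castSucc, Fin.val_succ, if_true, hL, of_apply, newtonProd_succ]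
        have h1 := hg0 k.castSucc
        have h2 := hg0 k.succ
        field_simp
        ring
      · intro j _ hj
        rw [if_neg]
        intro h
        exact hj (Fin.ext (by simpa using h.symm))
      · simp
    · rw [Finset.sum_eq_zero, add_zero]
      · rcases (Fin.le_last i).lt_or_eq with h | rfl
        · simp [hlow i _ h]
        · ring
      · intro j _
        rw [if_neg]
        simp only [Fin.val_last]
        omega
  set U := L⁻¹ * Q with hU
  have hLU : L * U = Q := by rw [hU, ← Matrix.mul_assoc, mul_nonsing_inv _ hdet, Matrix.one_mul]
  have hBU : U * J = B * U := by
    have hQJ : Q * J = diagonal μ * Q := by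
      rw [hJQ, ← Matrix.mul_assoc, ← Matrix.mul_assoc, hQ, Matrix.one_mul]
    have h1 : L * (U * J) = L * (B * U) := by
      rw [← Matrix.mul_assoc, hLU, hQJ, ← Matrix.mul_assoc, ← hLB, Matrix.mul_assoc, hLU]
    have h2 := congrArg (L⁻¹ * ·) h1
    simpa only [← Matrix.mul_assoc, nonsing_inv_mul _ hdet, Matrix.one_mul] using h2
  have hQ0 : 0 < Q 0 0 := by simpa [newtonProd_zero] using hpos 0
  have hU0 : ∀ i, U i 0 = if i = 0 then Q 0 0 else 0 := by
    intro i
    have h1 : ∀ j, Q j 0 = L j 0 * Q 0 0 := by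
      intro j
      simp only [hL, hg, of_apply, newtonProd_zero]
      field_simp
    have h2 : U i 0 = (L⁻¹ * L) i 0 * Q 0 0 := by
      rw [hU, mul_apply, mul_apply, Finset.sum_mul]
      exact Finset.sum_congr rfl fun j _ => by rw [h1 j]; ring
    rw [h2, nonsing_inv_mul _ hdet, one_apply, ite_mul, one_mul, zero_mul]
  -- That `U = L⁻¹ Q` is upper triangular with positive diagonal is carried from column to column by
  -- `U J = B U`. The first column starts the induction: those of `L` and `Q` are proportional.
  have key : ∀ k : Fin (m + 1), ∀ j ≤ k, (∀ i, j < i → U i j = 0) ∧ 0 < U j j := by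
    intro k
    induction k using Fin.induction with
    | zero =>
      intro j hj
      rw [Fin.le_zero_iff.1 hj]
      refine ⟨fun i hi => ?_, ?_⟩
      · rw [hU0, if_neg hi.ne']
      · rw [hU0, if_pos rfl]; exact hQ0
    | succ k ih =>
      intro j hj
      rcases hj.lt_or_eq with h | rfl
      · exact ih j (Fin.le_castSucc_iff.2 h)
      · have h1 : ∀ i, k.succ ≤ i → U i k.succ * J k.succ k.castSucc =
            (if k.succ = i then U k.castSucc k.castSucc * (g i / g k.castSucc) else 0) := by
          intro i hi
          have hki : k.castSucc < i := Fin.castSucc_lt_succ.trans_le hi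
          have h2 := congrFun (congrFun hBU i) k.castSucc
          rw [mul_apply, mul_apply, Finset.sum_eq_single k.succ] at h2
          · rw [h2]
            simp only [hB, of_apply, add_mul, Finset.sum_add_distrib, ite_mul, zero_mul,
              Finset.sum_ite_eq, Finset.mem_univ, if_true]
            rw [(ih _ le_rfl).1 i hki, mul_zero, zero_add]
            rw [Finset.sum_eq_single k.castSucc]
            · simp only [Fin.ext_iff, Fin.val_succ, Fin.val_castSucc]
              split_ifs
              · ring
              · rfl
            · intro j _ hj
              split_ifs with h3
              · rw [(ih _ le_rfl).1 j, mul_zero]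
                refine lt_of_le_of_ne ?_ hj.symm
                rw [Fin.le_def] at hi ⊢
                simp only [Fin.val_succ, Fin.val_castSucc] at hi ⊢
                omega
              · rfl
            · simp
          · intro j _ hj
            rcases lt_or_gt_of_ne hj with h | h
            · rw [(ih j (Fin.le_castSucc_iff.2 h)).1 i
                ((Fin.le_castSucc_iff.2 h).trans_lt hki), zero_mul]
            · rw [hJ.tridiag, mul_zero]
              simpa [Fin.lt_def] using h
          · simp
        refine ⟨fun i hi => ?_, ?_⟩
        · have h2 := h1 i hi.le
          rw [if_neg hi.ne] at h2
          exact (mul_eq_zero.1 h2).resolve_right (hJ.pos k).ne'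
        · have h2 := h1 _ le_rfl
          rw [if_pos rfl] at h2
          refine pos_of_mul_pos_left (b := J k.succ k.castSucc) ?_ (hJ.pos k).le
          rw [h2]
          exact mul_pos (ih _ le_rfl).2 (div_pos (hpos _) (hpos _))
  exact ⟨Q, L, U, hQ, hJQ, hlow, hone, fun i j h => (key j j le_rfl).1 i h,
    fun i => (key i i le_rfl).2, hLU.symm⟩

end IsJacobi

/-! ### Bidiagonal coordinates in terms of the first column of `Q` -/

/-- The product `∏_{j < k} β_j`. -/
def headProd {m : ℕ} (β : Fin m → ℝ) (k : Fin (m + 1)) : ℝ :=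
  ∏ j : Fin m with j.castSucc < k, β j

theorem headProd_zero {m : ℕ} (β : Fin m → ℝ) : headProd β 0 = 1 := by
  simp [headProd]

theorem headProd_succ {m : ℕ} (β : Fin m → ℝ) (k : Fin m) :
    headProd β k.succ = β k * headProd β k.castSucc := by
  have : (Finset.univ.filter fun j : Fin m => j.castSucc < k.succ) =
      insert k (Finset.univ.filter fun j : Fin m => j.castSucc < k.castSucc) := by
    ext j
    simp only [Finset.mem_filter, Finset.mem_univ, true_and, Finset.mem_insert, Fin.lt_def,
      Fin.ext_iff, Fin.val_succ, Fin.val_castSucc]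
    omega
  rw [headProd, this, Finset.prod_insert (by simp), headProd]

theorem headProd_pos {m : ℕ} {β : Fin m → ℝ} (hβ : ∀ i, 0 < β i) (k : Fin (m + 1)) :
    0 < headProd β k :=
  Finset.prod_pos fun j _ => hβ j

section bidiagonal

variable {m : ℕ} {J Q L U : Matrix (Fin (m + 1)) (Fin (m + 1)) ℝ} {μ : Fin (m + 1) → ℝ}

theorem IsPositiveLU.isUnit_det_lower {n : ℕ} {Q L U : Matrix (Fin n) (Fin n) ℝ}
    (h : IsPositiveLU Q L U) : IsUnit L.det := by
  rw [det_eq_one_of_lower_unipotent h.lower h.unipotent]; exact isUnit_one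

/-- The matrix `B = L⁻¹ Λ L` is lower triangular. -/
theorem IsPositiveLU.bidiagonal_lower (h : IsPositiveLU Q L U) {i j : Fin (m + 1)} (hij : i < j) :
    (L⁻¹ * diagonal μ * L) i j = 0 := by
  have hL : BlockTriangular L OrderDual.toDual := fun i j hij => h.lower i j hij
  have hD : BlockTriangular (diagonal μ) (OrderDual.toDual : Fin (m + 1) → _) :=
    blockTriangular_diagonal μ
  let _ := invertibleOfIsUnitDet L h.isUnit_det_lower
  have hL' : BlockTriangular L⁻¹ OrderDual.toDual := blockTriangular_inv_of_blockTriangular hL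
  exact (hL'.mul hD).mul hL hij

theorem IsPositiveLU.mul_bidiagonal (h : IsPositiveLU Q L U) :
    L * (L⁻¹ * diagonal μ * L) = diagonal μ * L := by
  rw [← Matrix.mul_assoc, ← Matrix.mul_assoc, mul_nonsing_inv _ h.isUnit_det_lower, Matrix.one_mul]

theorem IsPositiveLU.bidiagonal_mul (h : IsPositiveLU Q L U) (hQ : Q * Qᵀ = 1)
    (hJQ : J = Qᵀ * diagonal μ * Q) : (L⁻¹ * diagonal μ * L) * U = U * J := by
  have hQJ : Q * J = diagonal μ * Q := by
    rw [hJQ, ← Matrix.mul_assoc, ← Matrix.mul_assoc, hQ, Matrix.one_mul]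
  rw [Matrix.mul_assoc, ← h.eq_mul, Matrix.mul_assoc, ← hQJ, h.eq_mul, ← Matrix.mul_assoc,
    ← Matrix.mul_assoc, nonsing_inv_mul _ h.isUnit_det_lower, Matrix.one_mul]

/-- Compare the entries `(i, k)` of `B U = U J` for `i > k + 1`. The right side vanishes by the
shapes of `U` and `J`, and by induction on columns the left side is `B i k * U k k`. -/
theorem IsPositiveLU.bidiagonal_eq_zero (h : IsPositiveLU Q L U) (hJ : IsJacobi J)
    (hQ : Q * Qᵀ = 1) (hJQ : J = Qᵀ * diagonal μ * Q) (k : Fin (m + 1)) :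
    ∀ i : Fin (m + 1), (k : ℕ) + 1 < i → (L⁻¹ * diagonal μ * L) i k = 0 := by
  have hBU := h.bidiagonal_mul hQ hJQ
  set B := L⁻¹ * diagonal μ * L
  induction k using WellFoundedLT.induction with
  | ind k ih =>
    intro i hi
    have h1 := congrFun (congrFun hBU i) k
    rw [mul_apply, mul_apply, Finset.sum_eq_single k, Finset.sum_eq_zero] at h1
    · exact (mul_eq_zero.1 h1).resolve_right (h.pos k).ne'
    · intro j _
      by_cases hj : j < i
      · rw [h.upper i j hj, zero_mul]
      · rw [hJ.tridiag, mul_zero]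
        rw [not_lt, Fin.le_def] at hj
        omega
    · intro j _ hj
      rcases lt_or_gt_of_ne hj with hj | hj
      · rw [ih j hj i (by rw [Fin.lt_def] at hj; omega), zero_mul]
      · rw [h.upper j k hj, mul_zero]
    · simp

/-- The bidiagonal coordinates are `J_{k+1,k} U_{k+1,k+1} / U_{k,k}`. -/
theorem IsPositiveLU.bidiagonal_succ (h : IsPositiveLU Q L U) (hJ : IsJacobi J)
    (hQ : Q * Qᵀ = 1) (hJQ : J = Qᵀ * diagonal μ * Q) (k : Fin m) :
    (L⁻¹ * diagonal μ * L) k.succ k.castSucc * U k.castSucc k.castSucc =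
      J k.succ k.castSucc * U k.succ k.succ := by
  have h0 := h.bidiagonal_eq_zero hJ hQ hJQ
  have h1 := congrFun (congrFun (h.bidiagonal_mul hQ hJQ) k.succ) k.castSucc
  rw [mul_apply, mul_apply, Finset.sum_eq_single k.castSucc, Finset.sum_eq_single k.succ] at h1
  · rw [h1, mul_comm]
  · intro j _ hj
    rcases lt_or_gt_of_ne hj with hj | hj
    · rw [h.upper _ _ hj, zero_mul]
    · rw [hJ.tridiag, mul_zero]
      simpa [Fin.lt_def] using hj
  · simp
  · intro j _ hj
    rcases lt_or_gt_of_ne hj with hj | hj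
    · rw [h0 j, zero_mul]
      simpa [Fin.lt_def] using hj
    · rw [h.upper _ _ hj, mul_zero]
  · simp

/-- The lower factor is determined by its first column and the bidiagonal coordinates. -/
theorem IsPositiveLU.lower_mul_headProd (h : IsPositiveLU Q L U) (hJ : IsJacobi J)
    (hQ : Q * Qᵀ = 1) (hJQ : J = Qᵀ * diagonal μ * Q) {β : Fin m → ℝ}
    (hβ : ∀ k : Fin m, β k = (L⁻¹ * diagonal μ * L) k.succ k.castSucc) (i k : Fin (m + 1)) :
    L i k * headProd β k = newtonProd μ k (μ i) * L i 0 := by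
  induction k using Fin.induction with
  | zero => rw [headProd_zero, newtonProd_zero, mul_one, one_mul]
  | succ k ih =>
    have h0 := h.bidiagonal_eq_zero hJ hQ hJQ
    have hcol : ∀ i, μ i * L i k.castSucc =
        L i k.castSucc * (L⁻¹ * diagonal μ * L) k.castSucc k.castSucc + L i k.succ * β k := by
      intro i
      have h1 := congrFun (congrFun (h.mul_bidiagonal (μ := μ)) i) k.castSucc
      rw [diagonal_mul] at h1
      rw [← h1, mul_apply, hβ, Finset.sum_eq_add k.castSucc k.succ Fin.castSucc_lt_succ.ne]
      · intro j _ hj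
        rcases lt_or_gt_of_ne hj.1 with h2 | h2
        · rw [h.bidiagonal_lower h2, mul_zero]
        · rw [h0 k.castSucc j, mul_zero]
          rcases lt_or_gt_of_ne hj.2 with h3 | h3
          · exact absurd h2 (not_lt.2 (Fin.le_castSucc_iff.2 h3))
          · simpa [Fin.lt_def] using h3
      · simp
      · simp
    -- Row `k` of this relation identifies the diagonal entry of the bidiagonal matrix as `μ k`.
    have hdiag := hcol k.castSucc
    rw [h.unipotent, h.lower _ _ Fin.castSucc_lt_succ] at hdiag
    have hi := hcol i
    rw [headProd_succ, newtonProd_succ]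
    linear_combination (μ i - μ k.castSucc) * ih - hi * headProd β k.castSucc +
      L i k.castSucc * headProd β k.castSucc * hdiag

theorem IsPositiveLU.first_col (h : IsPositiveLU Q L U) (i : Fin (m + 1)) :
    Q i 0 = L i 0 * U 0 0 := by
  rw [h.eq_mul, mul_apply, Finset.sum_eq_single 0]
  · intro j _ hj
    rw [h.upper j 0 (Fin.pos_of_ne_zero hj), mul_zero]
  · simp

end bidiagonal

/-- The spectral theorem gives real eigenvalues. They are distinct because eigenvectors of a Jacobi
matrix are determined by their first component, so sorting makes them strictly increasing. -/
theorem IsJacobi.exists_isOrderedSpectrum {m : ℕ} {J : Matrix (Fin (m + 1)) (Fin (m + 1)) ℝ}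
    (hJ : IsJacobi J) : ∃ lam, IsOrderedSpectrum J lam := by
  have hH : J.IsHermitian := by
    rw [IsHermitian, conjTranspose_eq_transpose_of_trivial]; exact hJ.transpose_eq
  have hinj : Function.Injective hH.eigenvalues := by
    intro i j hij
    by_contra hne
    set u : Fin (m + 1) → Fin (m + 1) → ℝ := fun i => (hH.eigenvectorBasis i).ofLp with hu
    have hu1 : ∀ i, J *ᵥ u i = hH.eigenvalues i • u i := fun i => hH.mulVec_eigenvectorBasis i
    have hu0 : ∀ i, u i ≠ 0 := by
      intro i h
      exact hH.eigenvectorBasis.orthonormal.ne_zero i (by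
        rw [← WithLp.ofLp_eq_zero]; exact h)
    have h00 : ∀ i, u i 0 ≠ 0 := fun i h => hu0 i (hJ.eigenvector_eq_zero (hu1 i) h)
    -- This combination has zero first component and would be an eigenvector; its vanishing
    -- contradicts orthogonality of the two basis vectors.
    have hw : u j 0 • u i - u i 0 • u j = 0 := by
      refine hJ.eigenvector_eq_zero (z := hH.eigenvalues i) ?_ ?_
      · rw [mulVec_sub, mulVec_smul, mulVec_smul, hu1, hu1, ← hij, smul_sub, smul_comm,
          smul_comm (u i 0)]
      · simp [mul_comm]
    have hb : u j 0 • hH.eigenvectorBasis i = u i 0 • hH.eigenvectorBasis j := by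
      rw [← sub_eq_zero, ← WithLp.ofLp_eq_zero 2]
      exact hw
    have hin := congrArg (inner ℝ (hH.eigenvectorBasis i)) hb
    rw [inner_smul_right, inner_smul_right,
      orthonormal_iff_ite.1 hH.eigenvectorBasis.orthonormal i i,
      orthonormal_iff_ite.1 hH.eigenvectorBasis.orthonormal i j, if_pos rfl, if_neg hne, mul_one,
      mul_zero] at hin
    exact h00 j hin
  refine ⟨hH.eigenvalues ∘ Tuple.sort hH.eigenvalues, ?_, ?_⟩
  · exact (Tuple.monotone_sort _).strictMono_of_injective
      (hinj.comp (Equiv.injective _))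
  · rw [hH.charpoly_eq]
    exact (Equiv.prod_comp (Tuple.sort hH.eigenvalues)
      fun i => Polynomial.X - Polynomial.C (hH.eigenvalues i)).symm

/-! ### Lax equation and isospectrality -/

/-- Entrywise derivative of a matrix-valued function. -/
def HasEntrywiseDerivAt {n : ℕ} (M : ℝ → Matrix (Fin n) (Fin n) ℝ) (M' : Matrix (Fin n) (Fin n) ℝ)
    (t : ℝ) : Prop :=
  ∀ i j, HasDerivAt (fun s => M s i j) (M' i j) t

theorem HasEntrywiseDerivAt.mul {n : ℕ} {M N : ℝ → Matrix (Fin n) (Fin n) ℝ}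
    {M' N' : Matrix (Fin n) (Fin n) ℝ} {t : ℝ} (hM : HasEntrywiseDerivAt M M' t)
    (hN : HasEntrywiseDerivAt N N' t) :
    HasEntrywiseDerivAt (fun s => M s * N s) (M' * N t + M t * N') t := by
  intro i j
  simp only [mul_apply, Matrix.add_apply, ← Finset.sum_add_distrib]
  exact HasDerivAt.fun_sum fun k _ => (hM i k).mul (hN k j)

/-- Along a Lax equation `J' = [A, J]`, polynomials in `J` satisfy the same equation. -/
theorem HasEntrywiseDerivAt.aeval {n : ℕ} {J : ℝ → Matrix (Fin n) (Fin n) ℝ}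
    {A : Matrix (Fin n) (Fin n) ℝ} {t : ℝ} (hJ : HasEntrywiseDerivAt J (A * J t - J t * A) t)
    (f : Polynomial ℝ) : HasEntrywiseDerivAt (fun s => Polynomial.aeval (J s) f)
      (A * Polynomial.aeval (J t) f - Polynomial.aeval (J t) f * A) t := by
  induction f using Polynomial.induction_on with
  | C a =>
    intro i j
    simp only [Polynomial.aeval_C, ← Algebra.commutes a A, sub_self]
    exact hasDerivAt_const _ _
  | add p q hp hq =>
    intro i j
    have e : A * Polynomial.aeval (J t) (p + q) - Polynomial.aeval (J t) (p + q) * A =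
        (A * Polynomial.aeval (J t) p - Polynomial.aeval (J t) p * A) +
        (A * Polynomial.aeval (J t) q - Polynomial.aeval (J t) q * A) := by
      rw [map_add]; noncomm_ring
    rw [e]
    simp only [map_add]
    exact (hp i j).add (hq i j)
  | monomial k a h =>
    have h2 := h.mul hJ
    have e : ∀ M : Matrix (Fin n) (Fin n) ℝ,
        Polynomial.aeval M (Polynomial.C a * Polynomial.X ^ (k + 1)) =
        Polynomial.aeval M (Polynomial.C a * Polynomial.X ^ k) * M := by
      intro M
      rw [pow_succ, ← mul_assoc, map_mul _ _ Polynomial.X, Polynomial.aeval_X]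
    simp only [e]
    convert h2 using 1
    noncomm_ring

theorem sum_sum_mul_eq_trace {n : ℕ} (Y M : Matrix (Fin n) (Fin n) ℝ) :
    ∑ i, ∑ j, Y i j * M i j = (Yᵀ * M).trace := by
  rw [Finset.sum_comm]
  rfl

/-- A solution of `Y' = [A, Y]` with antisymmetric `A` vanishes if it vanishes initially. -/
theorem eq_zero_of_lax {n : ℕ} {Y A : ℝ → Matrix (Fin n) (Fin n) ℝ} (hA : ∀ t, (A t)ᵀ = -A t)
    (hY : ∀ t, HasEntrywiseDerivAt Y (A t * Y t - Y t * A t) t) (h0 : Y 0 = 0) (t : ℝ) :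
    Y t = 0 := by
  -- The squared Frobenius norm of `Y` is constant, since `tr (Yᵀ A Y)` and `tr (Yᵀ Y A)` vanish for
  -- antisymmetric `A`.
  have hder : ∀ t, HasDerivAt (fun s => ∑ i, ∑ j, Y s i j * Y s i j) 0 t := by
    intro t
    have h1 : HasDerivAt (fun s => ∑ i, ∑ j, Y s i j * Y s i j)
        (∑ i, ∑ j, ((A t * Y t - Y t * A t) i j * Y t i j +
          Y t i j * (A t * Y t - Y t * A t) i j)) t :=
      HasDerivAt.fun_sum fun i _ => HasDerivAt.fun_sum fun j _ => (hY t i j).mul (hY t i j)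
    have h2 : ((Y t)ᵀ * (A t * Y t)).trace = 0 := by
      have := trace_transpose ((Y t)ᵀ * (A t * Y t))
      rw [transpose_mul, transpose_mul, transpose_transpose, hA, Matrix.mul_neg, Matrix.neg_mul,
        trace_neg, Matrix.mul_assoc] at this
      linarith
    have h3 : ((Y t)ᵀ * (Y t * A t)).trace = 0 := by
      have := trace_transpose ((Y t)ᵀ * (Y t * A t))
      rw [transpose_mul, transpose_mul, transpose_transpose, hA, Matrix.neg_mul, Matrix.neg_mul,
        trace_neg, Matrix.mul_assoc, trace_mul_comm, Matrix.mul_assoc] at this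
      linarith
    have h4 : ∑ i, ∑ j, ((A t * Y t - Y t * A t) i j * Y t i j +
          Y t i j * (A t * Y t - Y t * A t) i j) = 0 := by
      have : ∀ i j, (A t * Y t - Y t * A t) i j * Y t i j +
          Y t i j * (A t * Y t - Y t * A t) i j =
          2 * (Y t i j * (A t * Y t - Y t * A t) i j) := fun i j => by ring
      simp only [this, ← Finset.mul_sum]
      rw [sum_sum_mul_eq_trace, Matrix.mul_sub, trace_sub, h2, h3]
      simp
    rwa [h4] at h1
  have h1 := eq_of_forall_hasDerivAt_zero hder t 0
  simp only [h0, Matrix.zero_apply, mul_zero, Finset.sum_const_zero] at h1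
  ext i j
  have h2 := (Finset.sum_eq_zero_iff_of_nonneg fun i _ =>
    Finset.sum_nonneg fun j _ => mul_self_nonneg _).1 h1 i (Finset.mem_univ i)
  have h3 := (Finset.sum_eq_zero_iff_of_nonneg fun j _ => mul_self_nonneg _).1 h2 j
    (Finset.mem_univ j)
  exact mul_self_eq_zero.1 h3

/-- The strictly upper triangular part of Flaschka's matrix. -/
noncomputable def flaschkaUpper {n : ℕ} (s : TodaState n) : Matrix (Fin n) (Fin n) ℝ :=
  of fun i j => if (i : ℕ) + 1 = j then Real.exp ((s.1 i - s.1 j) / 2) / 2 else 0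

theorem flaschka_eq {n : ℕ} (s : TodaState n) : flaschka s =
    diagonal (fun k => -(s.2 k) / 2) + flaschkaUpper s + (flaschkaUpper s)ᵀ := by
  ext i j
  simp only [flaschka, flaschkaUpper, of_apply, Matrix.add_apply, transpose_apply, diagonal_apply]
  rcases lt_trichotomy i j with h | rfl | h
  · have h' : (i : ℕ) < j := h
    simp [h.ne, show ¬ ((j : ℕ) + 1 = i) by omega]
  · simp
  · have h' : (j : ℕ) < i := h
    simp [h.ne', show ¬ ((i : ℕ) + 1 = j) by omega]

/-- This is the diagonal part of the Lax equation. As `S` lives on one superdiagonal, `S Sᵀ` and `Sᵀ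
S` are diagonal and carry the interactions with the right and left neighbours. -/
theorem diagonal_force_eq {n : ℕ} (s : TodaState n) :
    diagonal (fun k => -(todaForce s.1 k) / 2) =
      2 * (flaschkaUpper s * (flaschkaUpper s)ᵀ) - 2 * ((flaschkaUpper s)ᵀ * flaschkaUpper s) := by
  have hexp : ∀ u : ℝ, Real.exp (u / 2) / 2 * (Real.exp (u / 2) / 2) = Real.exp u / 4 := by
    intro u
    rw [div_mul_div_comm, ← Real.exp_add]; norm_num
  have h1 : flaschkaUpper s * (flaschkaUpper s)ᵀ = diagonal fun k : Fin n =>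
      if h : (k : ℕ) + 1 < n then Real.exp (s.1 k - s.1 ⟨(k : ℕ) + 1, h⟩) / 4 else 0 := by
    ext i j
    rw [mul_apply, diagonal_apply]
    split_ifs with hij hi
    · subst hij
      rw [Finset.sum_eq_single ⟨(i : ℕ) + 1, hi⟩]
      · simp [flaschkaUpper, hexp]
      · intro k _ hk
        have : ¬ ((i : ℕ) + 1 = k) := fun h => hk (Fin.ext h.symm)
        simp [flaschkaUpper, this]
      · simp
    · subst hij
      refine Finset.sum_eq_zero fun k _ => ?_
      have : ¬ ((i : ℕ) + 1 = k) := by omega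
      simp [flaschkaUpper, this]
    · refine Finset.sum_eq_zero fun k _ => ?_
      have : ¬ ((i : ℕ) + 1 = k) ∨ ¬ ((j : ℕ) + 1 = k) := by
        by_contra! h
        exact hij (Fin.ext (by omega))
      rcases this with h | h <;> simp [flaschkaUpper, h]
  have h2 : (flaschkaUpper s)ᵀ * flaschkaUpper s = diagonal fun k : Fin n =>
      if 0 < (k : ℕ) then Real.exp (s.1 ⟨(k : ℕ) - 1, by omega⟩ - s.1 k) / 4 else 0 := by
    ext i j
    rw [mul_apply, diagonal_apply]
    split_ifs with hij hi
    · subst hij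
      rw [Finset.sum_eq_single ⟨(i : ℕ) - 1, by omega⟩]
      · simp [flaschkaUpper, hexp, Nat.sub_add_cancel hi]
      · intro k _ hk
        have : ¬ ((k : ℕ) + 1 = i) := fun h => hk (Fin.ext (by simp only; omega))
        simp [flaschkaUpper, this]
      · simp
    · subst hij
      refine Finset.sum_eq_zero fun k _ => ?_
      have : ¬ ((k : ℕ) + 1 = i) := by omega
      simp [flaschkaUpper, this]
    · refine Finset.sum_eq_zero fun k _ => ?_
      have : ¬ ((k : ℕ) + 1 = i) ∨ ¬ ((k : ℕ) + 1 = j) := by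
        by_contra! h
        exact hij (Fin.ext (by omega))
      rcases this with h | h <;> simp [flaschkaUpper, h]
  rw [h1, h2, two_mul, two_mul, diagonal_add, diagonal_add, diagonal_sub]
  congr 1
  ext k
  unfold todaForce
  split_ifs <;> ring

/-- The Lax equation of the Toda lattice. -/
theorem IsTodaTrajectory.hasEntrywiseDerivAt_flaschka {n : ℕ} {q : ℝ → TodaState n}
    (hq : IsTodaTrajectory q) (t : ℝ) :
    HasEntrywiseDerivAt (fun s => flaschka (q s))
      ((flaschkaUpper (q t) - (flaschkaUpper (q t))ᵀ) * flaschka (q t) -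
        flaschka (q t) * (flaschkaUpper (q t) - (flaschkaUpper (q t))ᵀ)) t := by
  set D : Matrix (Fin n) (Fin n) ℝ := diagonal (fun k => -((q t).2 k) / 2) with hD
  set S := flaschkaUpper (q t) with hS
  set S' : Matrix (Fin n) (Fin n) ℝ := S * D - D * S with hS'
  have hSder : HasEntrywiseDerivAt (fun s => flaschkaUpper (q s)) S' t := by
    intro i j
    rw [hS', Matrix.sub_apply, hD, mul_diagonal, diagonal_mul, hS]
    simp only [flaschkaUpper, of_apply]
    split_ifs
    · have := ((((hq t i).1.sub (hq t j).1).div_const 2).exp).div_const 2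
      exact this.congr_deriv (by simp only [Pi.sub_apply]; ring)
    · simpa using hasDerivAt_const t (0 : ℝ)
  have hDder : HasEntrywiseDerivAt
      (fun s => (diagonal (fun k => -((q s).2 k) / 2) : Matrix (Fin n) (Fin n) ℝ))
      (2 * (S * Sᵀ) - 2 * (Sᵀ * S)) t := by
    rw [hS, ← diagonal_force_eq]
    intro i j
    simp only [diagonal_apply]
    split_ifs
    · exact ((hq t i).2.neg).div_const 2
    · exact hasDerivAt_const _ _
  have e : (S - Sᵀ) * flaschka (q t) - flaschka (q t) * (S - Sᵀ) =
      (2 * (S * Sᵀ) - 2 * (Sᵀ * S)) + S' + S'ᵀ := by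
    rw [flaschka_eq, hS', transpose_sub, transpose_mul, transpose_mul, hD, diagonal_transpose]
    noncomm_ring
  rw [e]
  intro i j
  simp only [flaschka_eq]
  exact ((hDder i j).add (hSder i j)).add (hSder j i)

theorem transpose_sub_transpose_self {n : ℕ} (S : Matrix (Fin n) (Fin n) ℝ) :
    (S - Sᵀ)ᵀ = -(S - Sᵀ) := by
  rw [transpose_sub, transpose_transpose, neg_sub]

/-- Polynomial relations of Flaschka's matrix are preserved by the Toda flow. -/
theorem IsTodaTrajectory.aeval_flaschka_eq_zero {n : ℕ} {q : ℝ → TodaState n}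
    (hq : IsTodaTrajectory q) {f : Polynomial ℝ} (h0 : Polynomial.aeval (flaschka (q 0)) f = 0)
    (t : ℝ) : Polynomial.aeval (flaschka (q t)) f = 0 :=
  eq_zero_of_lax (Y := fun s => Polynomial.aeval (flaschka (q s)) f)
    (A := fun s => flaschkaUpper (q s) - (flaschkaUpper (q s))ᵀ)
    (fun _ => transpose_sub_transpose_self _)
    (fun t => (hq.hasEntrywiseDerivAt_flaschka t).aeval f) h0 t

theorem aeval_transpose_mul_diagonal_mul {n : ℕ} {Q : Matrix (Fin n) (Fin n) ℝ} (hQ : Q * Qᵀ = 1)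
    (μ : Fin n → ℝ) (f : Polynomial ℝ) : Polynomial.aeval (Qᵀ * diagonal μ * Q) f =
      Qᵀ * diagonal (fun i => f.eval (μ i)) * Q := by
  induction f using Polynomial.induction_on with
  | C a =>
    simp only [Polynomial.aeval_C, Polynomial.eval_C]
    have : (diagonal fun _ => a : Matrix (Fin n) (Fin n) ℝ) = algebraMap ℝ _ a := by
      rw [algebraMap_eq_diagonal]; rfl
    rw [this, ← Algebra.commutes, Matrix.mul_assoc, mul_eq_one_comm.1 hQ, Matrix.mul_one]
  | add p q hp hq =>
    simp only [map_add, Polynomial.eval_add, hp, hq]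
    rw [← diagonal_add, Matrix.mul_add, Matrix.add_mul]
  | monomial k a h =>
    rw [pow_succ, ← mul_assoc, map_mul, h, Polynomial.aeval_X]
    have e : Qᵀ * diagonal (fun i => (Polynomial.C a * Polynomial.X ^ k).eval (μ i)) * Q *
        (Qᵀ * diagonal μ * Q) =
        Qᵀ * diagonal (fun i => (Polynomial.C a * Polynomial.X ^ k).eval (μ i)) * (Q * Qᵀ) *
        diagonal μ * Q := by simp only [Matrix.mul_assoc]
    rw [e, hQ, Matrix.mul_one, Matrix.mul_assoc Qᵀ, diagonal_mul_diagonal]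
    simp [mul_assoc]

/-- The Toda flow is isospectral. -/
theorem IsTodaTrajectory.charpoly_flaschka {m : ℕ} {q : ℝ → TodaState (m + 1)}
    (hq : IsTodaTrajectory q) {μ : Fin (m + 1) → ℝ}
    (hμ : (flaschka (q 0)).charpoly = ∏ i, (Polynomial.X - Polynomial.C (μ i))) (t : ℝ) :
    (flaschka (q t)).charpoly = ∏ i, (Polynomial.X - Polynomial.C (μ i)) := by
  have hJ := isJacobi_flaschka (q t)
  obtain ⟨ν, hν, hchar⟩ := hJ.exists_isOrderedSpectrum
  have hzero : Polynomial.aeval (flaschka (q t)) (∏ i, (Polynomial.X - Polynomial.C (μ i))) = 0 :=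
    hq.aeval_flaschka_eq_zero (by rw [← hμ]; exact Matrix.aeval_self_charpoly _) t
  obtain ⟨Q, hQ, hJQ, -⟩ := hJ.exists_orthonormal_eigenvectors hν.injective hchar
    (s := fun _ => 1) fun _ => one_ne_zero
  rw [hJQ, aeval_transpose_mul_diagonal_mul hQ] at hzero
  have hdiag : diagonal (fun i => (∏ j, (Polynomial.X - Polynomial.C (μ j))).eval (ν i)) = 0 := by
    have := congrArg (fun M => Q * M * Qᵀ) hzero
    simp only [Matrix.mul_zero, Matrix.zero_mul] at this
    rw [← this]
    have e : ∀ D : Matrix (Fin (m + 1)) (Fin (m + 1)) ℝ,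
        Q * (Qᵀ * D * Q) * Qᵀ = (Q * Qᵀ) * D * (Q * Qᵀ) := fun D => by
      simp only [Matrix.mul_assoc]
    rw [e, hQ, Matrix.one_mul, Matrix.mul_one]
  -- The initial characteristic polynomial annihilates `J(t)`, so every eigenvalue at time `t` is
  -- one of the `μ j`. Distinctness of the `ν i` makes this matching a bijection.
  have hroot : ∀ i, ∃ j, ν i = μ j := by
    intro i
    have h1 := congrFun (congrFun hdiag i) i
    rw [diagonal_apply_eq, Matrix.zero_apply, Polynomial.eval_prod, Finset.prod_eq_zero_iff] at h1
    obtain ⟨j, -, hj⟩ := h1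
    exact ⟨j, by simpa [sub_eq_zero] using hj⟩
  choose σ hσ using hroot
  have hσi : Function.Injective σ := fun i j h => hν.injective (by rw [hσ, hσ, h])
  rw [hchar]
  simp only [hσ]
  exact Function.Bijective.prod_comp (Finite.injective_iff_bijective.1 hσi)
    fun j => Polynomial.X - Polynomial.C (μ j)

/-! ### Motion of the first components of eigenvectors -/

theorem eq_exp_mul_of_hasDerivAt {F : ℝ → ℝ} {c : ℝ} (hF : ∀ t, HasDerivAt F (c * F t) t) (t : ℝ) :
    F t = Real.exp (c * t) * F 0 := by
  have h : ∀ t, HasDerivAt (fun s => Real.exp (-(c * s)) * F s) 0 t := by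
    intro t
    have h1 : HasDerivAt (fun s => Real.exp (-(c * s))) (Real.exp (-(c * t)) * (-(c * 1))) t :=
      (((hasDerivAt_id t).const_mul c).neg).exp
    have h2 := h1.mul (hF t)
    exact h2.congr_deriv (by ring)
  have h1 := eq_of_forall_hasDerivAt_zero h t 0
  simp only [mul_zero, neg_zero, Real.exp_zero, one_mul] at h1
  rw [← h1, ← mul_assoc, ← Real.exp_add, add_neg_cancel, Real.exp_zero, one_mul]

/-- Evolution of the first components of the normalized eigenvectors. -/
theorem IsTodaTrajectory.first_component_sq {m : ℕ} {q : ℝ → TodaState (m + 1)}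
    (hq : IsTodaTrajectory q) {μ : Fin (m + 1) → ℝ} (hinj : Function.Injective μ)
    {t : ℝ} {Q Q' : Matrix (Fin (m + 1)) (Fin (m + 1)) ℝ} (hQ : Q * Qᵀ = 1) (hQ' : Q' * Q'ᵀ = 1)
    (hJ : flaschka (q 0) = Qᵀ * diagonal μ * Q) (hJ' : flaschka (q t) = Q'ᵀ * diagonal μ * Q')
    (i : Fin (m + 1)) : Q' i 0 ^ 2 =
      Real.exp (2 * μ i * t) * (Real.exp ((q t).1 0 - (q 0).1 0) * Q i 0 ^ 2) := by
  -- Up to a factor, `g` is the Lagrange polynomial at `μ i`: `g(J)` is a multiple of the spectral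
  -- projection, with corner entry `g(μ i) * Q i 0 ^ 2`.
  set g : Polynomial ℝ := ∏ j ∈ Finset.univ.erase i, (Polynomial.X - Polynomial.C (μ j)) with hg
  have hg0 : g.eval (μ i) ≠ 0 := by
    rw [hg, Polynomial.eval_prod]
    refine Finset.prod_ne_zero_iff.2 fun j hj => ?_
    simpa [sub_eq_zero] using hinj.ne (Finset.ne_of_mem_erase hj).symm
  have hgj : ∀ j, j ≠ i → g.eval (μ j) = 0 := by
    intro j hj
    rw [hg, Polynomial.eval_prod]
    exact Finset.prod_eq_zero (Finset.mem_erase.2 ⟨hj, Finset.mem_univ j⟩) (by simp)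
  have hentry : ∀ R : Matrix (Fin (m + 1)) (Fin (m + 1)) ℝ, R * Rᵀ = 1 →
      Polynomial.aeval (Rᵀ * diagonal μ * R) g 0 0 = g.eval (μ i) * R i 0 ^ 2 := by
    intro R hR
    rw [aeval_transpose_mul_diagonal_mul hR, mul_apply, Finset.sum_eq_single i]
    · rw [mul_diagonal, transpose_apply]; ring
    · intro j _ hj
      rw [mul_diagonal, hgj j hj, mul_zero, zero_mul]
    · simp
  have hzero0 : Polynomial.aeval (flaschka (q 0)) ((Polynomial.X - Polynomial.C (μ i)) * g) = 0 := by
    rw [hJ, aeval_transpose_mul_diagonal_mul hQ]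
    have : (fun j => ((Polynomial.X - Polynomial.C (μ i)) * g).eval (μ j)) = 0 := by
      funext j
      rw [Polynomial.eval_mul]
      by_cases h : j = i
      · simp [h]
      · simp [hgj j h]
    rw [this, diagonal_zero', Matrix.mul_zero, Matrix.zero_mul]
  have hF : ∀ t, HasDerivAt
      (fun s => Real.exp (-(q s).1 0) * Polynomial.aeval (flaschka (q s)) g 0 0)
      (2 * μ i * (Real.exp (-(q t).1 0) * Polynomial.aeval (flaschka (q t)) g 0 0)) t := by
    intro t
    have hzero := hq.aeval_flaschka_eq_zero hzero0 t
    have h1 := ((hq t 0).1.neg.exp).mul ((hq.hasEntrywiseDerivAt_flaschka t).aeval g 0 0)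
    set G := Polynomial.aeval (flaschka (q t)) g with hG
    set S := flaschkaUpper (q t) with hS
    set D : Matrix (Fin (m + 1)) (Fin (m + 1)) ℝ := diagonal (fun k => -((q t).2 k) / 2) with hD
    have hJS : flaschka (q t) = D + S + Sᵀ := flaschka_eq _
    have hleft : flaschka (q t) * G = μ i • G := by
      rw [map_mul, map_sub, Polynomial.aeval_X, Polynomial.aeval_C, Matrix.sub_mul, sub_eq_zero,
        ← Algebra.smul_def] at hzero
      exact hzero
    have hright : G * flaschka (q t) = μ i • G := by
      rw [← hleft]
      have := congrArg (Polynomial.aeval (flaschka (q t))) (mul_comm g Polynomial.X)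
      rwa [map_mul, map_mul, Polynomial.aeval_X] at this
    -- With `J G = G J = μ_i G` and `J = D + S + Sᵀ`, the commutator is rewritten so that the
    -- remaining `S` terms vanish in the corner. What is left is `(2 μ_i + y_0) G_{00}`, and the
    -- factor `exp (-x_0)` absorbs `y_0`.
    have e : (S - Sᵀ) * G - G * (S - Sᵀ) =
        μ i • G + μ i • G - D * G - G * D - 2 * (Sᵀ * G) - 2 * (G * S) := by
      nth_rewrite 1 [← hleft]
      rw [← hright, hJS]
      noncomm_ring
    have hS0 : ∀ k, S k 0 = 0 := fun k => by simp [hS, flaschkaUpper]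
    have h2 : (Sᵀ * G) 0 0 = 0 := by
      rw [mul_apply]
      exact Finset.sum_eq_zero fun k _ => by rw [transpose_apply, hS0, zero_mul]
    have h3 : (G * S) 0 0 = 0 := by
      rw [mul_apply]
      exact Finset.sum_eq_zero fun k _ => by rw [hS0, mul_zero]
    have h4 : ((S - Sᵀ) * G - G * (S - Sᵀ)) 0 0 = (2 * μ i + (q t).2 0) * G 0 0 := by
      rw [e]
      simp only [two_mul, Matrix.sub_apply, Matrix.add_apply, Matrix.smul_apply, smul_eq_mul, h2, h3, hD, diagonal_mul,
        mul_diagonal]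
      ring
    rw [h4] at h1
    refine h1.congr_deriv ?_
    simp only [Pi.neg_apply]
    ring
  have h1 := eq_exp_mul_of_hasDerivAt hF t
  rw [hJ, hJ', hentry Q hQ, hentry Q' hQ', Real.exp_neg, Real.exp_neg] at h1
  have h2 := Real.exp_pos ((q t).1 0)
  have h3 := Real.exp_pos ((q 0).1 0)
  rw [Real.exp_sub]
  field_simp at h1 ⊢
  linear_combination h1

section factors

variable {m : ℕ} {J Q L U : Matrix (Fin (m + 1)) (Fin (m + 1)) ℝ} {μ : Fin (m + 1) → ℝ}

theorem IsPositiveLU.bidiagonal_pos (h : IsPositiveLU Q L U) (hJ : IsJacobi J)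
    (hQ : Q * Qᵀ = 1) (hJQ : J = Qᵀ * diagonal μ * Q) (k : Fin m) :
    0 < (L⁻¹ * diagonal μ * L) k.succ k.castSucc := by
  refine pos_of_mul_pos_left (b := U k.castSucc k.castSucc) ?_ (h.pos _).le
  rw [h.bidiagonal_succ hJ hQ hJQ]
  exact mul_pos (hJ.pos k) (h.pos _)

theorem IsPositiveLU.headProd_mul (h : IsPositiveLU Q L U) (hJ : IsJacobi J)
    (hQ : Q * Qᵀ = 1) (hJQ : J = Qᵀ * diagonal μ * Q) {β : Fin m → ℝ}
    (hβ : ∀ k : Fin m, β k = (L⁻¹ * diagonal μ * L) k.succ k.castSucc) (k : Fin (m + 1)) :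
    headProd β k * Q 0 0 = newtonProd μ k (μ k) * Q k 0 := by
  have h1 := h.lower_mul_headProd hJ hQ hJQ hβ k k
  rw [h.unipotent, one_mul] at h1
  rw [h.first_col 0, h.first_col k, h.unipotent, h1]
  ring

theorem IsPositiveLU.first_col_zero_pos (h : IsPositiveLU Q L U) : 0 < Q 0 0 := by
  rw [h.first_col, h.unipotent, one_mul]; exact h.pos 0

theorem IsPositiveLU.first_col_ne_zero (h : IsPositiveLU Q L U) (hJ : IsJacobi J)
    (hQ : Q * Qᵀ = 1) (hJQ : J = Qᵀ * diagonal μ * Q) (k : Fin (m + 1)) : Q k 0 ≠ 0 := by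
  intro h0
  have h1 := h.headProd_mul hJ hQ hJQ (fun _ => rfl) k
  rw [h0, mul_zero] at h1
  exact (mul_pos (headProd_pos (h.bidiagonal_pos hJ hQ hJQ) k) h.first_col_zero_pos).ne' h1

theorem IsPositiveLU.lower_mul_first_col (h : IsPositiveLU Q L U) (hJ : IsJacobi J)
    (hQ : Q * Qᵀ = 1) (hJQ : J = Qᵀ * diagonal μ * Q) (i k : Fin (m + 1)) :
    L i k * (newtonProd μ k (μ k) * Q k 0) = newtonProd μ k (μ i) * Q i 0 := by
  rw [← h.headProd_mul hJ hQ hJQ (fun _ => rfl) k, ← mul_assoc,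
    h.lower_mul_headProd hJ hQ hJQ (fun _ => rfl) i k, h.first_col 0, h.first_col i, h.unipotent]
  ring

end factors

/-! ### Limits of the triangular factors -/

/-- If the lower factors of LU-positive orthogonal matrices tend to `1`, so do the upper ones. -/
theorem IsPositiveLU.tendsto_upper {n : ℕ} {Q L U : ℝ → Matrix (Fin n) (Fin n) ℝ} {l : Filter ℝ}
    (h : ∀ t, IsPositiveLU (Q t) (L t) (U t)) (hQ : ∀ t, Q t * (Q t)ᵀ = 1)
    (hL : Tendsto L l (𝓝 1)) : Tendsto U l (𝓝 1) := by
  have hLinv : Tendsto (fun t => (L t)⁻¹) l (𝓝 1) := by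
    have h1 : ∀ t, (L t)⁻¹ = (L t).adjugate := fun t => by
      rw [Matrix.inv_def, det_eq_one_of_lower_unipotent (h t).lower (h t).unipotent,
        Ring.inverse_one, one_smul]
    simp only [h1]
    have h2 : Continuous fun M : Matrix (Fin n) (Fin n) ℝ => M.adjugate :=
      continuous_id.matrix_adjugate
    have h3 := (h2.tendsto 1).comp hL
    rwa [adjugate_one] at h3
  have htr : Continuous fun M : Matrix (Fin n) (Fin n) ℝ => M * Mᵀ :=
    continuous_id.matrix_mul continuous_id.matrix_transpose
  have htr' : Continuous fun M : Matrix (Fin n) (Fin n) ℝ => Mᵀ * M :=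
    continuous_id.matrix_transpose.matrix_mul continuous_id
  have hU : ∀ t, U t = (L t)⁻¹ * Q t := fun t => by
    rw [(h t).eq_mul, ← Matrix.mul_assoc, nonsing_inv_mul _
      (by rw [det_eq_one_of_lower_unipotent (h t).lower (h t).unipotent]; exact isUnit_one),
      Matrix.one_mul]
  have hUU : Tendsto (fun t => U t * (U t)ᵀ) l (𝓝 1) := by
    have h1 : ∀ t, U t * (U t)ᵀ = (L t)⁻¹ * ((L t)⁻¹)ᵀ := fun t => by
      rw [hU, transpose_mul, Matrix.mul_assoc, ← Matrix.mul_assoc (Q t), hQ, Matrix.one_mul]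
    simp only [h1]
    simpa [Function.comp_def] using (htr.tendsto 1).comp hLinv
  have hLL : Tendsto (fun t => (L t)ᵀ * L t) l (𝓝 1) := by
    simpa [Function.comp_def] using (htr'.tendsto 1).comp hL
  have hentry : ∀ {M : ℝ → Matrix (Fin n) (Fin n) ℝ}, Tendsto M l (𝓝 1) → ∀ k,
      Tendsto (fun t => M t k k) l (𝓝 1) := fun {M} hM k => by
    have := (tendsto_pi_nhds.1 (tendsto_pi_nhds.1 hM k)) k
    rwa [one_apply_eq] at this
  have hUdiag : ∀ k t, U t k k ^ 2 ≤ (U t * (U t)ᵀ) k k := fun k t => by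
    rw [mul_apply]
    have := Finset.single_le_sum (f := fun j => U t k j * (U t)ᵀ j k)
      (fun j _ => mul_self_nonneg _) (Finset.mem_univ k)
    simpa [sq] using this
  -- `Qᵀ L` is the inverse of `U`, hence upper triangular with diagonal `1 / U k k`, while its Gram
  -- matrix is `Lᵀ L`. This bounds `U k k` from below; `U Uᵀ = L⁻¹ (L⁻¹)ᵀ` bounds it from above.
  have hLdiag : ∀ k t, 1 ≤ ((L t)ᵀ * L t) k k * U t k k ^ 2 := fun k t => by
    set X := (Q t)ᵀ * L t with hX
    have hXU : X * U t = 1 := by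
      rw [hX, Matrix.mul_assoc, ← (h t).eq_mul]
      exact mul_eq_one_comm.1 (hQ t)
    have hXX : (L t)ᵀ * L t = Xᵀ * X := by
      rw [hX, transpose_mul, transpose_transpose, Matrix.mul_assoc, ← Matrix.mul_assoc (Q t), hQ,
        Matrix.one_mul]
    let _ := invertibleOfLeftInverse _ _ hXU
    have hUt : BlockTriangular (U t) id := fun i j hij => (h t).upper i j hij
    have hXt : BlockTriangular X id := by
      rw [← inv_eq_left_inv hXU]; exact blockTriangular_inv_of_blockTriangular hUt
    have hkk : X k k * U t k k = 1 := by
      have h1 := congrFun (congrFun hXU k) k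
      rw [mul_apply, Finset.sum_eq_single k, one_apply_eq] at h1
      · exact h1
      · intro j _ hj
        rcases lt_or_gt_of_ne hj with hj | hj
        · rw [hXt hj, zero_mul]
        · rw [hUt hj, mul_zero]
      · simp
    have h2 : X k k ^ 2 ≤ (Xᵀ * X) k k := by
      rw [mul_apply]
      have := Finset.single_le_sum (f := fun j => Xᵀ k j * X j k)
        (fun j _ => mul_self_nonneg _) (Finset.mem_univ k)
      simpa [sq] using this
    rw [hXX, ← one_pow 2, ← hkk, mul_pow]
    gcongr
  have hsq : ∀ k, Tendsto (fun t => U t k k ^ 2) l (𝓝 1) := fun k => by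
    refine tendsto_of_tendsto_of_tendsto_of_le_of_le (g := fun t => (((L t)ᵀ * L t) k k)⁻¹)
      (by simpa using (hentry hLL k).inv₀ one_ne_zero) (hentry hUU k) (fun t => ?_) (hUdiag k)
    have h1 := hLdiag k t
    have h2 : 0 < ((L t)ᵀ * L t) k k :=
      pos_of_mul_pos_left (zero_lt_one.trans_le h1) (sq_nonneg _)
    exact (inv_le_iff_one_le_mul₀' h2).2 h1
  refine tendsto_pi_nhds.2 fun i => tendsto_pi_nhds.2 fun j => ?_
  rcases lt_trichotomy i j with hij | rfl | hij
  · rw [one_apply_ne hij.ne]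
    -- Row `i` of `U` has squared norm tending to `1`, already exhausted by its diagonal entry.
    have h1 : Tendsto (fun t => (U t * (U t)ᵀ) i i - U t i i ^ 2) l (𝓝 0) := by
      simpa using (hentry hUU i).sub (hsq i)
    have h2 : Tendsto (fun t => U t i j ^ 2) l (𝓝 0) := by
      refine squeeze_zero (fun t => sq_nonneg _) (fun t => ?_) h1
      rw [mul_apply, ← Finset.add_sum_erase _ _ (Finset.mem_univ i)]
      have := Finset.single_le_sum (f := fun k => U t i k * (U t)ᵀ k i)
        (s := Finset.univ.erase i) (fun j _ => mul_self_nonneg _)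
        (Finset.mem_erase.2 ⟨hij.ne', Finset.mem_univ j⟩)
      simp only [transpose_apply] at this ⊢
      nlinarith
    have h3 := h2.sqrt
    rw [Real.sqrt_zero] at h3
    simp only [Real.sqrt_sq_eq_abs] at h3
    exact (tendsto_zero_iff_abs_tendsto_zero _).2 h3
  · rw [one_apply_eq]
    have h3 := (hsq i).sqrt
    rw [Real.sqrt_one] at h3
    exact h3.congr fun t => Real.sqrt_sq ((h t).pos i).le
  · rw [one_apply_ne hij.ne']
    exact tendsto_const_nhds.congr fun t => ((h t).upper i j hij).symm

/-! ### Recovering positions from gaps; conserved sums -/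

/-- The linear form recovering the `k`-th coordinate of a sum-zero vector from its successive
differences. -/
noncomputable def differenceForm {m : ℕ} (δ : Fin m → ℝ) (k : Fin (m + 1)) : ℝ :=
  (∑ j : Fin m with j.val < k.val, -((j.val : ℝ) + 1) / ((m + 1 : ℕ) : ℝ) * δ j) +
    ∑ j : Fin m with k.val ≤ j.val,
      (((m + 1 : ℕ) : ℝ) - ((j.val : ℝ) + 1)) / ((m + 1 : ℕ) : ℝ) * δ j

/-- Abel summation: the weights drop by one at each step, so every `z k` with `k > 0` gets
coefficient `-1`. This is the case `k = 0` of `differenceForm_sub`. -/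
theorem sum_mul_sub_succ {m : ℕ} (z : Fin (m + 1) → ℝ) :
    ∑ j : Fin m, ((m : ℝ) - j.val) * (z j.castSucc - z j.succ) =
      ((m : ℝ) + 1) * z 0 - ∑ k, z k := by
  induction m with
  | zero => simp
  | succ m ih =>
    have h1 := ih fun k => z k.succ
    rw [Fin.sum_univ_succ, Fin.sum_univ_succ (f := z)]
    have h2 : ∑ j : Fin m, (((m + 1 : ℕ) : ℝ) - (j.succ.val : ℝ)) *
        (z j.succ.castSucc - z j.succ.succ) =
        ∑ j : Fin m, ((m : ℝ) - j.val) * (z j.castSucc.succ - z j.succ.succ) := by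
      refine Finset.sum_congr rfl fun j _ => ?_
      rw [Fin.succ_castSucc]
      push_cast [Fin.val_succ]
      ring
    rw [h2, h1]
    push_cast [Fin.val_zero]
    simp only [Fin.castSucc_zero, Fin.succ_zero_eq_one]
    ring

theorem differenceForm_succ {m : ℕ} (δ : Fin m → ℝ) (k : Fin m) :
    differenceForm δ k.castSucc = differenceForm δ k.succ + δ k := by
  have h1 : (Finset.univ.filter fun j : Fin m => j.val < k.succ.val) =
      insert k (Finset.univ.filter fun j : Fin m => j.val < k.castSucc.val) := by
    ext j
    simp only [Finset.mem_filter, Finset.mem_univ, true_and, Finset.mem_insert,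
      Fin.ext_iff, Fin.val_succ, Fin.val_castSucc]
    omega
  have h2 : (Finset.univ.filter fun j : Fin m => k.castSucc.val ≤ j.val) =
      insert k (Finset.univ.filter fun j : Fin m => k.succ.val ≤ j.val) := by
    ext j
    simp only [Finset.mem_filter, Finset.mem_univ, true_and, Finset.mem_insert,
      Fin.ext_iff, Fin.val_succ, Fin.val_castSucc]
    omega
  rw [differenceForm, differenceForm, h1, h2, Finset.sum_insert (by simp),
    Finset.sum_insert (by simp)]
  have : ((m + 1 : ℕ) : ℝ) ≠ 0 := by positivity
  field_simp
  ring

theorem differenceForm_sub {m : ℕ} (z : Fin (m + 1) → ℝ) (k : Fin (m + 1)) :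
    differenceForm (fun j => z j.castSucc - z j.succ) k =
      z k - (∑ i, z i) / ((m + 1 : ℕ) : ℝ) := by
  induction k using Fin.induction with
  | zero =>
    have h1 := sum_mul_sub_succ z
    have h2 : ((m + 1 : ℕ) : ℝ) ≠ 0 := by positivity
    have h3 : differenceForm (fun j => z j.castSucc - z j.succ) 0 =
        (∑ j : Fin m, ((m : ℝ) - j.val) * (z j.castSucc - z j.succ)) / ((m + 1 : ℕ) : ℝ) := by
      simp only [differenceForm, Fin.val_zero, not_lt_zero, Finset.filter_false, Finset.sum_empty,
        zero_le, Finset.filter_true, zero_add, Finset.sum_div]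
      refine Finset.sum_congr rfl fun j _ => ?_
      push_cast
      ring
    rw [h3, h1]
    push_cast at h2 ⊢
    field_simp
  | succ k ih =>
    rw [differenceForm_succ] at ih
    linarith

theorem tendsto_differenceForm {m : ℕ} {δ : ℝ → Fin m → ℝ} {δ' : Fin m → ℝ} {l : Filter ℝ}
    (h : ∀ j, Tendsto (fun t => δ t j) l (𝓝 (δ' j))) (k : Fin (m + 1)) :
    Tendsto (fun t => differenceForm (δ t) k) l (𝓝 (differenceForm δ' k)) :=
  (tendsto_finsetSum _ fun j _ => (h j).const_mul _).add
    (tendsto_finsetSum _ fun j _ => (h j).const_mul _)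

theorem wavePhase_eq {m : ℕ} (β : Fin m → ℝ) (k : Fin (m + 1)) :
    wavePhase (n := m + 1) β k = differenceForm (fun j => 2 * Real.log (β j)) k +
      (((m + 1 : ℕ) : ℝ) - 2 * ((k.val : ℝ) + 1) + 1) * Real.log 2 := by
  unfold wavePhase differenceForm
  congr 1
  congr 1 <;> refine Finset.sum_congr rfl fun j _ => ?_ <;> ring

theorem sum_sub_two_mul_eq_zero (n : ℕ) :
    ∑ k : Fin n, ((n : ℝ) - 2 * ((k.val : ℝ) + 1) + 1) = 0 := by
  have h1 := Equiv.sum_comp Fin.revPerm fun k : Fin n => ((n : ℝ) - 2 * ((k.val : ℝ) + 1) + 1)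
  have h2 : ∀ k : Fin n, (n : ℝ) - 2 * (((Fin.revPerm k).val : ℝ) + 1) + 1 =
      -((n : ℝ) - 2 * ((k.val : ℝ) + 1) + 1) := by
    intro k
    rw [Fin.revPerm_apply, Fin.val_rev, Nat.cast_sub (by omega)]
    push_cast
    ring
  simp only [h2, Finset.sum_neg_distrib] at h1
  linarith

theorem IsTodaTrajectory.sum_velocities {n : ℕ} {q : ℝ → TodaState n} (hq : IsTodaTrajectory q)
    (hy : ∑ k, (q 0).2 k = 0) (t : ℝ) : ∑ k, (q t).2 k = 0 := by
  rw [← hy]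
  refine eq_of_forall_hasDerivAt_zero (f := fun t => ∑ k, (q t).2 k) (fun t => ?_) t 0
  have h1 : HasDerivAt (fun t => ∑ k, (q t).2 k) (∑ k, chainForce Real.exp (q t).1 k) t :=
    HasDerivAt.fun_sum fun k _ => (hq t k).2
  rwa [sum_chainForce] at h1

theorem IsTodaTrajectory.sum_positions {n : ℕ} {q : ℝ → TodaState n} (hq : IsTodaTrajectory q)
    (hx : ∑ k, (q 0).1 k = 0) (hy : ∑ k, (q 0).2 k = 0) (t : ℝ) : ∑ k, (q t).1 k = 0 := by
  rw [← hx]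
  refine eq_of_forall_hasDerivAt_zero (f := fun t => ∑ k, (q t).1 k) (fun t => ?_) t 0
  have h1 : HasDerivAt (fun t => ∑ k, (q t).1 k) (∑ k, (q t).2 k) t :=
    HasDerivAt.fun_sum fun k _ => (hq t k).1
  rwa [hq.sum_velocities hy] at h1

theorem sum_eigenvalues_eq_zero {n : ℕ} {s : TodaState n} (hy : ∑ k, s.2 k = 0)
    {Q : Matrix (Fin n) (Fin n) ℝ} {μ : Fin n → ℝ} (hQ : Q * Qᵀ = 1)
    (hJQ : flaschka s = Qᵀ * diagonal μ * Q) : ∑ k, μ k = 0 := by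
  have h1 : (flaschka s).trace = ∑ k, μ k := by
    rw [hJQ, Matrix.mul_assoc, trace_mul_comm, Matrix.mul_assoc, hQ, Matrix.mul_one, trace_diagonal]
  rw [← h1, trace]
  simp only [diag_apply, flaschka_self, ← Finset.sum_div, Finset.sum_neg_distrib, hy, neg_zero,
    zero_div]

/-! ### Evolution of the factors and asymptotics -/

section evolution

variable {m : ℕ} {q : ℝ → TodaState (m + 1)} {μ : Fin (m + 1) → ℝ} {t : ℝ}
  {Q L U Q' L' U' : Matrix (Fin (m + 1)) (Fin (m + 1)) ℝ}

/-- In the formula for `L i k` by first-column entries the Newton products are constant in time, and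
the common factor of `first_component_sq` cancels in `Q i 0 / Q k 0`. Squares suffice for the limit.
-/
theorem IsTodaTrajectory.lower_sq (hq : IsTodaTrajectory q) (hinj : Function.Injective μ)
    (hQ : Q * Qᵀ = 1) (hQ' : Q' * Q'ᵀ = 1) (hJ : flaschka (q 0) = Qᵀ * diagonal μ * Q)
    (hJ' : flaschka (q t) = Q'ᵀ * diagonal μ * Q') (h : IsPositiveLU Q L U)
    (h' : IsPositiveLU Q' L' U') (i k : Fin (m + 1)) :
    L' i k ^ 2 = (Real.exp ((μ i - μ k) * t) * L i k) ^ 2 := by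
  have hjac := isJacobi_flaschka (q 0)
  have h1 := h.lower_mul_first_col hjac hQ hJ i k
  have h2 := h'.lower_mul_first_col (isJacobi_flaschka (q t)) hQ' hJ' i k
  have h3 := hq.first_component_sq hinj hQ hQ' hJ hJ' i
  have h4 := hq.first_component_sq hinj hQ hQ' hJ hJ' k
  have hN := newtonProd_self_ne_zero hinj k
  have hQk := h.first_col_ne_zero hjac hQ hJ k
  have e0 := (Real.exp_pos ((q t).1 0 - (q 0).1 0)).ne'
  have ek := (Real.exp_pos (2 * μ k * t)).ne'
  have e1 : Real.exp (2 * μ i * t) =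
      Real.exp (2 * μ k * t) * Real.exp ((μ i - μ k) * t) ^ 2 := by
    rw [← Real.exp_nat_mul, ← Real.exp_add]; congr 1; push_cast; ring
  have h5 : L' i k ^ 2 * (newtonProd μ k (μ k) ^ 2 * Q' k 0 ^ 2) =
      newtonProd μ k (μ i) ^ 2 * Q' i 0 ^ 2 := by rw [← mul_pow, ← mul_pow, h2, mul_pow]
  have h6 : L i k ^ 2 * (newtonProd μ k (μ k) ^ 2 * Q k 0 ^ 2) =
      newtonProd μ k (μ i) ^ 2 * Q i 0 ^ 2 := by rw [← mul_pow, ← mul_pow, h1, mul_pow]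
  rw [h3, h4, e1] at h5
  have hne : Real.exp (2 * μ k * t) * Real.exp ((q t).1 0 - (q 0).1 0) *
      (newtonProd μ k (μ k) ^ 2 * Q k 0 ^ 2) ≠ 0 := by positivity
  refine mul_right_cancel₀ hne ?_
  linear_combination h5 - Real.exp (2 * μ k * t) * Real.exp ((q t).1 0 - (q 0).1 0) *
    Real.exp ((μ i - μ k) * t) ^ 2 * h6

theorem IsTodaTrajectory.headProd_eq (hq : IsTodaTrajectory q) (hinj : Function.Injective μ)
    (hQ : Q * Qᵀ = 1) (hQ' : Q' * Q'ᵀ = 1) (hJ : flaschka (q 0) = Qᵀ * diagonal μ * Q)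
    (hJ' : flaschka (q t) = Q'ᵀ * diagonal μ * Q') (h : IsPositiveLU Q L U)
    (h' : IsPositiveLU Q' L' U') {β β' : Fin m → ℝ}
    (hβ : ∀ k : Fin m, β k = (L⁻¹ * diagonal μ * L) k.succ k.castSucc)
    (hβ' : ∀ k : Fin m, β' k = (L'⁻¹ * diagonal μ * L') k.succ k.castSucc) (k : Fin (m + 1)) :
    headProd β' k = Real.exp ((μ k - μ 0) * t) * headProd β k := by
  have hjac := isJacobi_flaschka (q 0)
  have hjac' := isJacobi_flaschka (q t)
  have h1 := h.headProd_mul hjac hQ hJ hβ k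
  have h2 := h'.headProd_mul hjac' hQ' hJ' hβ' k
  have h3 := hq.first_component_sq hinj hQ hQ' hJ hJ' 0
  have h4 := hq.first_component_sq hinj hQ hQ' hJ hJ' k
  have hpos : 0 < headProd β k :=
    headProd_pos (fun i => by rw [hβ]; exact h.bidiagonal_pos hjac hQ hJ i) k
  have hpos' : 0 < headProd β' k :=
    headProd_pos (fun i => by rw [hβ']; exact h'.bidiagonal_pos hjac' hQ' hJ' i) k
  have hQ0 := h.first_col_zero_pos.ne'
  have e1 : Real.exp (2 * μ k * t) =
      Real.exp (2 * μ 0 * t) * Real.exp ((μ k - μ 0) * t) ^ 2 := by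
    rw [← Real.exp_nat_mul, ← Real.exp_add]; congr 1; push_cast; ring
  have h5 : headProd β' k ^ 2 * Q' 0 0 ^ 2 = newtonProd μ k (μ k) ^ 2 * Q' k 0 ^ 2 := by
    rw [← mul_pow, h2, mul_pow]
  have h6 : headProd β k ^ 2 * Q 0 0 ^ 2 = newtonProd μ k (μ k) ^ 2 * Q k 0 ^ 2 := by
    rw [← mul_pow, h1, mul_pow]
  rw [h3, h4, e1] at h5
  have hne : Real.exp (2 * μ 0 * t) * Real.exp ((q t).1 0 - (q 0).1 0) * Q 0 0 ^ 2 ≠ 0 := by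
    positivity
  refine (pow_left_inj₀ hpos'.le (by positivity) two_ne_zero).1 (mul_right_cancel₀ hne ?_)
  linear_combination h5 - Real.exp (2 * μ 0 * t) * Real.exp ((q t).1 0 - (q 0).1 0) *
    Real.exp ((μ k - μ 0) * t) ^ 2 * h6

/-- The bidiagonal coordinates evolve linearly in time, up to taking logarithms. -/
theorem IsTodaTrajectory.bidiagonal_eq (hq : IsTodaTrajectory q) (hinj : Function.Injective μ)
    (hQ : Q * Qᵀ = 1) (hQ' : Q' * Q'ᵀ = 1) (hJ : flaschka (q 0) = Qᵀ * diagonal μ * Q)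
    (hJ' : flaschka (q t) = Q'ᵀ * diagonal μ * Q') (h : IsPositiveLU Q L U)
    (h' : IsPositiveLU Q' L' U') {β β' : Fin m → ℝ}
    (hβ : ∀ k : Fin m, β k = (L⁻¹ * diagonal μ * L) k.succ k.castSucc)
    (hβ' : ∀ k : Fin m, β' k = (L'⁻¹ * diagonal μ * L') k.succ k.castSucc) (k : Fin m) :
    β' k = Real.exp ((μ k.succ - μ k.castSucc) * t) * β k := by
  have h1 := hq.headProd_eq hinj hQ hQ' hJ hJ' h h' hβ hβ' k.succ
  have h2 := hq.headProd_eq hinj hQ hQ' hJ hJ' h h' hβ hβ' k.castSucc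
  have hpos : 0 < headProd β k.castSucc := headProd_pos
    (fun i => by rw [hβ]; exact h.bidiagonal_pos (isJacobi_flaschka (q 0)) hQ hJ i) _
  rw [headProd_succ, headProd_succ, h2] at h1
  have e1 : Real.exp ((μ k.succ - μ 0) * t) =
      Real.exp ((μ k.succ - μ k.castSucc) * t) * Real.exp ((μ k.castSucc - μ 0) * t) := by
    rw [← Real.exp_add]; congr 1; ring
  rw [e1] at h1
  have := Real.exp_pos ((μ k.castSucc - μ 0) * t)
  have hne : Real.exp ((μ k.castSucc - μ 0) * t) * headProd β k.castSucc ≠ 0 := by positivity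
  refine mul_right_cancel₀ hne ?_
  linear_combination h1

/-- Asymptotics of a Toda trajectory in bidiagonal coordinates, for an ordering `μ` of the spectrum
that is adapted to the direction of time `l`. -/
theorem IsTodaTrajectory.hasAsymptotics (hq : IsTodaTrajectory q) (hx : ∑ k, (q 0).1 k = 0)
    (hy : ∑ k, (q 0).2 k = 0) (hinj : Function.Injective μ)
    (hμ : (flaschka (q 0)).charpoly = ∏ i, (Polynomial.X - Polynomial.C (μ i)))
    (hQ : Q * Qᵀ = 1) (hJ : flaschka (q 0) = Qᵀ * diagonal μ * Q) (h : IsPositiveLU Q L U)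
    {β : Fin m → ℝ} (hβ : ∀ k : Fin m, β k = (L⁻¹ * diagonal μ * L) k.succ k.castSucc)
    {l : Filter ℝ} (hl : ∀ k i, k < i → Tendsto (fun t => (μ i - μ k) * t) l atBot) :
    HasAsymptotics l q (fun k => -2 * μ k, fun k => wavePhase (n := m + 1) β k) := by
  -- The diagonalization is chosen separately at each time; no continuity of the choice is needed.
  have hex := fun t => (isJacobi_flaschka (q t)).exists_isPositiveLU hinj
    (hq.charpoly_flaschka hμ t)
  choose Qt Lt Ut hQt hJt hLU using hex
  have hLt : Tendsto Lt l (𝓝 1) := by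
    refine tendsto_pi_nhds.2 fun i => tendsto_pi_nhds.2 fun k => ?_
    rcases lt_trichotomy i k with hik | rfl | hik
    · rw [one_apply_ne hik.ne]
      exact tendsto_const_nhds.congr fun t => ((hLU t).lower i k hik).symm
    · rw [one_apply_eq]
      exact tendsto_const_nhds.congr fun t => ((hLU t).unipotent i).symm
    · rw [one_apply_ne hik.ne', tendsto_zero_iff_abs_tendsto_zero]
      have h1 : ∀ t, Real.exp ((μ i - μ k) * t) * |L i k| = |Lt t i k| := fun t => by
        have := hq.lower_sq hinj hQ (hQt t) hJ (hJt t) h (hLU t) i k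
        rw [sq_eq_sq_iff_abs_eq_abs, abs_mul, abs_of_pos (Real.exp_pos _)] at this
        exact this.symm
      refine Tendsto.congr h1 ?_
      simpa using (Real.tendsto_exp_atBot.comp (hl k i hik)).mul_const |L i k|
  have hUt := IsPositiveLU.tendsto_upper hLU hQt hLt
  have hQlim : Tendsto Qt l (𝓝 1) := by
    have h1 : Continuous fun p : Matrix (Fin (m + 1)) (Fin (m + 1)) ℝ ×
      Matrix (Fin (m + 1)) (Fin (m + 1)) ℝ => p.1 * p.2 := continuous_fst.matrix_mul continuous_snd
    have h2 := (h1.tendsto (1, 1)).comp (hLt.prodMk_nhds hUt)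
    rw [Matrix.one_mul] at h2
    exact h2.congr fun t => (hLU t).eq_mul.symm
  have hJlim : Tendsto (fun t => flaschka (q t)) l (𝓝 (diagonal μ)) := by
    have h1 : Continuous fun M : Matrix (Fin (m + 1)) (Fin (m + 1)) ℝ => Mᵀ * diagonal μ * M :=
      (continuous_id.matrix_transpose.matrix_mul continuous_const).matrix_mul continuous_id
    have h2 := (h1.tendsto 1).comp hQlim
    rw [transpose_one, Matrix.one_mul, Matrix.mul_one] at h2
    exact h2.congr fun t => (hJt t).symm
  have hlogU : ∀ k, Tendsto (fun t => Real.log (Ut t k k)) l (𝓝 0) := fun k => by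
    have h1 := tendsto_pi_nhds.1 (tendsto_pi_nhds.1 hUt k) k
    rw [one_apply_eq] at h1
    simpa using h1.log one_ne_zero
  have hβpos : ∀ k, 0 < β k := fun k => by
    rw [hβ]; exact h.bidiagonal_pos (isJacobi_flaschka (q 0)) hQ hJ k
  have hdiff : ∀ t (j : Fin m), (q t).1 j.castSucc - (q t).1 j.succ =
      2 * Real.log 2 + 2 * Real.log (β j) + 2 * ((μ j.succ - μ j.castSucc) * t) +
        2 * (Real.log (Ut t j.castSucc j.castSucc) - Real.log (Ut t j.succ j.succ)) := by
    intro t j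
    have h1 := (hLU t).bidiagonal_succ (isJacobi_flaschka (q t)) (hQt t) (hJt t) j
    rw [hq.bidiagonal_eq hinj hQ (hQt t) hJ (hJt t) h (hLU t) hβ (fun _ => rfl) j,
      flaschka_succ_castSucc] at h1
    have h2 := congrArg Real.log h1
    have p1 := (hLU t).pos j.castSucc
    have p2 := (hLU t).pos j.succ
    have p3 := hβpos j
    rw [Real.log_mul (by positivity) p1.ne', Real.log_mul (by positivity) p3.ne', Real.log_exp,
      Real.log_mul (by positivity) p2.ne', Real.log_div (by positivity) two_ne_zero,
      Real.log_exp] at h2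
    linarith
  have hsumμ := sum_eigenvalues_eq_zero hy hQ hJ
  intro k
  constructor
  -- Removing the uniform motion and the `log 2` shift leaves a vector with zero sum whose
  -- successive differences tend to `2 log β_j`.
  · set z : ℝ → Fin (m + 1) → ℝ := fun t i => (q t).1 i + 2 * μ i * t -
      (((m + 1 : ℕ) : ℝ) - 2 * ((i.val : ℝ) + 1) + 1) * Real.log 2 with hz
    have hzsum : ∀ t, ∑ i, z t i = 0 := fun t => by
      rw [hz]
      rw [Finset.sum_sub_distrib, Finset.sum_add_distrib, ← Finset.sum_mul, ← Finset.sum_mul,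
        ← Finset.mul_sum, hsumμ, hq.sum_positions hx hy, sum_sub_two_mul_eq_zero]
      ring
    have hzk : ∀ t, differenceForm (fun j => z t j.castSucc - z t j.succ) k = z t k := fun t => by
      rw [differenceForm_sub, hzsum, zero_div, sub_zero]
    have hlim : Tendsto (fun t => z t k) l
        (𝓝 (differenceForm (fun j => 2 * Real.log (β j)) k)) := by
      simp only [← hzk]
      refine tendsto_differenceForm (fun j => ?_) k
      have h1 : Tendsto (fun t => 2 * Real.log (β j) +
          2 * (Real.log (Ut t j.castSucc j.castSucc) - Real.log (Ut t j.succ j.succ))) l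
          (𝓝 (2 * Real.log (β j) + 2 * (0 - 0))) :=
        (((hlogU _).sub (hlogU _)).const_mul 2).const_add _
      rw [sub_zero, mul_zero, add_zero] at h1
      refine h1.congr fun t => ?_
      simp only [hz, Fin.val_castSucc, Fin.val_succ]
      push_cast
      linear_combination -(hdiff t j)
    have h2 := hlim.sub_const (differenceForm (fun j => 2 * Real.log (β j)) k)
    rw [sub_self] at h2
    refine h2.congr fun t => ?_
    simp only [hz, wavePhase_eq]
    ring
  · have h1 := (tendsto_pi_nhds.1 (tendsto_pi_nhds.1 hJlim k) k).const_mul (-2)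
    rw [diagonal_apply_eq] at h1
    refine h1.congr fun t => ?_
    rw [flaschka_self]; ring

end evolution

/-! ### Comparison of the two orderings -/

/-- By `headProd_mul`, `2 log β_j` is the successive difference of `-2 log |N_k(μ_k) Q_{k0}|`, so
`differenceForm` returns that quantity minus its mean. The two factors may be negative: `Real.log`
sees only absolute values. -/
theorem wavePhase_eq_of_isPositiveLU {m : ℕ} {J Q L U : Matrix (Fin (m + 1)) (Fin (m + 1)) ℝ}
    {μ : Fin (m + 1) → ℝ} (hinj : Function.Injective μ) (h : IsPositiveLU Q L U) (hJ : IsJacobi J)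
    (hQ : Q * Qᵀ = 1) (hJQ : J = Qᵀ * diagonal μ * Q) {β : Fin m → ℝ}
    (hβ : ∀ k : Fin m, β k = (L⁻¹ * diagonal μ * L) k.succ k.castSucc) (k : Fin (m + 1)) :
    wavePhase (n := m + 1) β k =
      -2 * (Real.log (newtonProd μ k (μ k)) + Real.log (Q k 0)) +
        2 * (∑ i, (Real.log (newtonProd μ i (μ i)) + Real.log (Q i 0))) / ((m + 1 : ℕ) : ℝ) +
        (((m + 1 : ℕ) : ℝ) - 2 * ((k.val : ℝ) + 1) + 1) * Real.log 2 := by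
  have hβpos : ∀ k, 0 < β k := fun k => by rw [hβ]; exact h.bidiagonal_pos hJ hQ hJQ k
  have hG : ∀ k, Real.log (newtonProd μ k (μ k)) + Real.log (Q k 0) =
      Real.log (headProd β k) + Real.log (Q 0 0) := fun k => by
    rw [← Real.log_mul (newtonProd_self_ne_zero hinj k) (h.first_col_ne_zero hJ hQ hJQ k),
      ← h.headProd_mul hJ hQ hJQ hβ k,
      Real.log_mul (headProd_pos hβpos k).ne' h.first_col_zero_pos.ne']
  have hdiff : (fun j => 2 * Real.log (β j)) = fun j : Fin m =>
      -2 * (Real.log (newtonProd μ j.castSucc (μ j.castSucc)) + Real.log (Q j.castSucc 0)) -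
      -2 * (Real.log (newtonProd μ j.succ (μ j.succ)) + Real.log (Q j.succ 0)) := by
    funext j
    rw [hG, hG, headProd_succ, Real.log_mul (hβpos j).ne' (headProd_pos hβpos _).ne']
    ring
  rw [wavePhase_eq, hdiff, differenceForm_sub fun k =>
    -2 * (Real.log (newtonProd μ k (μ k)) + Real.log (Q k 0)), ← Finset.mul_sum]
  ring

theorem log_newtonProd {m : ℕ} {μ : Fin (m + 1) → ℝ} (hinj : Function.Injective μ)
    (k : Fin (m + 1)) : Real.log (newtonProd μ k (μ k)) =
      ∑ j with j < k, Real.log (μ k - μ j) := by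
  have e : Finset.Iio k = Finset.univ.filter fun j => j < k := by ext; simp
  rw [newtonProd, e, Real.log_prod]
  intro j hj
  exact sub_ne_zero.2 (hinj.ne (Finset.mem_filter.1 hj).2.ne')

theorem log_newtonProd_rev {m : ℕ} {lam : Fin (m + 1) → ℝ} (hinj : Function.Injective lam)
    (k : Fin (m + 1)) : Real.log (newtonProd (fun i => lam i.rev) k.rev (lam k.rev.rev)) =
      ∑ j with k < j, Real.log (lam k - lam j) := by
  rw [log_newtonProd (μ := fun i => lam i.rev) (hinj.comp Fin.rev_injective)]
  refine Finset.sum_nbij' Fin.rev Fin.rev ?_ ?_ ?_ ?_ ?_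
  · intro j hj; simpa [Fin.lt_rev_iff] using hj
  · intro j hj; simpa using hj
  · intro j _; exact Fin.rev_rev j
  · intro j _; exact Fin.rev_rev j
  · intro j _; rw [Fin.rev_rev]

/-- The relation between the phases for the two orderings of the spectrum. -/
theorem wavePhase_rev {m : ℕ} {s : TodaState (m + 1)} {lam : Fin (m + 1) → ℝ}
    (hinj : Function.Injective lam) {Q L U Q' L' U' : Matrix (Fin (m + 1)) (Fin (m + 1)) ℝ}
    (h : IsPositiveLU Q L U) (h' : IsPositiveLU Q' L' U')
    (hQ : Q * Qᵀ = 1) (hQ' : Q' * Q'ᵀ = 1) (hJQ : flaschka s = Qᵀ * diagonal lam * Q)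
    (hJQ' : flaschka s = Q'ᵀ * diagonal (fun i : Fin (m + 1) => lam i.rev) * Q') {β β' : Fin m → ℝ}
    (hβ : ∀ k : Fin m, β k = (L⁻¹ * diagonal lam * L) k.succ k.castSucc)
    (hβ' : ∀ k : Fin m,
      β' k = (L'⁻¹ * diagonal (fun i : Fin (m + 1) => lam i.rev) * L') k.succ k.castSucc) (k : Fin (m + 1)) :
    wavePhase (n := m + 1) β' k.rev = wavePhase (n := m + 1) β k +
      2 * ∑ j with j < k, Real.log |-2 * lam j - -2 * lam k| -
      2 * ∑ j with k < j, Real.log |-2 * lam j - -2 * lam k| := by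
  have hinj' : Function.Injective fun i : Fin (m + 1) => lam i.rev := hinj.comp Fin.rev_injective
  have hcol : ∀ i, Real.log (Q' i.rev 0) = Real.log (Q i 0) := by
    intro i
    -- At time `0`, `first_component_sq` says that two orthogonal diagonalizations of the same
    -- matrix have equal first components up to sign. It is applied to `Q` and to `Q'` with its rows
    -- reversed.
    obtain ⟨q, ⟨hq, rfl⟩, -⟩ := existsUnique_isTodaTrajectory s
    set R : Matrix (Fin (m + 1)) (Fin (m + 1)) ℝ := of fun i j => Q' i.rev j with hR
    have hRR : R * Rᵀ = 1 := by
      ext a b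
      have := congrFun (congrFun hQ' a.rev) b.rev
      rw [one_apply] at this ⊢
      simp only [Fin.rev_inj] at this
      exact this
    have hJR : flaschka (q 0) = Rᵀ * diagonal lam * R := by
      rw [hJQ']
      ext a b
      rw [mul_apply, mul_apply, ← Equiv.sum_comp Fin.revPerm]
      refine Finset.sum_congr rfl fun c _ => ?_
      simp [mul_diagonal, hR]
    have h1 := hq.first_component_sq hinj hQ hRR hJQ hJR i
    rw [mul_zero, Real.exp_zero, sub_self, Real.exp_zero, one_mul, one_mul,
      sq_eq_sq_iff_abs_eq_abs] at h1
    rw [← Real.log_abs, ← Real.log_abs (Q i 0), ← h1]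
    rfl
  -- The means agree: each pair of eigenvalues contributes once for either ordering, and the
  -- logarithm ignores the sign of the difference.
  have hsum : ∑ i, (Real.log (newtonProd (fun i => lam i.rev) i (lam i.rev)) +
      Real.log (Q' i 0)) = ∑ i, (Real.log (newtonProd lam i (lam i)) + Real.log (Q i 0)) := by
    rw [← Equiv.sum_comp Fin.revPerm]
    simp only [Fin.revPerm_apply, log_newtonProd_rev hinj, log_newtonProd hinj, hcol,
      Finset.sum_add_distrib, Finset.sum_filter]
    congr 1
    rw [Finset.sum_comm]
    refine Finset.sum_congr rfl fun i _ => Finset.sum_congr rfl fun j _ => ?_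
    split_ifs
    · rw [← Real.log_neg_eq_log, neg_sub]
    · rfl
  -- Velocities are `-2` times eigenvalues, so each logarithm carries a `log 2`. There are `k` of
  -- them below and `m - k` above, which accounts for the different `log 2` terms of the two phases.
  have hlog : ∀ j, j ≠ k → Real.log |-2 * lam j - -2 * lam k| =
      Real.log 2 + Real.log (lam k - lam j) := by
    intro j hj
    rw [Real.log_abs, ← Real.log_mul two_ne_zero (sub_ne_zero.2 (hinj.ne hj.symm))]
    congr 1; ring
  have hlt : ∑ j with j < k, Real.log |-2 * lam j - -2 * lam k| =
      k.val * Real.log 2 + ∑ j with j < k, Real.log (lam k - lam j) := by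
    rw [Finset.sum_congr rfl fun j hj => hlog j (Finset.mem_filter.1 hj).2.ne,
      Finset.sum_add_distrib, Finset.sum_const, nsmul_eq_mul]
    congr 3
    have e : (Finset.univ.filter fun j => j < k) = Finset.Iio k := by ext; simp
    rw [e, Fin.card_Iio]
  have hgt : ∑ j with k < j, Real.log |-2 * lam j - -2 * lam k| =
      ((m : ℝ) - k.val) * Real.log 2 + ∑ j with k < j, Real.log (lam k - lam j) := by
    rw [Finset.sum_congr rfl fun j hj => hlog j (Finset.mem_filter.1 hj).2.ne',
      Finset.sum_add_distrib, Finset.sum_const, nsmul_eq_mul]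
    congr 2
    have e : (Finset.univ.filter fun j => k < j) = Finset.Ioi k := by ext; simp
    rw [e, Fin.card_Ioi, show m + 1 - 1 - k.val = m - k.val by omega,
      Nat.cast_sub (Nat.lt_succ_iff.1 k.isLt)]
  rw [wavePhase_eq_of_isPositiveLU hinj h (isJacobi_flaschka s) hQ hJQ hβ,
    wavePhase_eq_of_isPositiveLU hinj' h' (isJacobi_flaschka s) hQ' hJQ' hβ', hsum, hcol,
    log_newtonProd_rev hinj, log_newtonProd hinj, hlt, hgt, Fin.val_rev,
    Nat.cast_sub (by omega)]
  push_cast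
  ring

/-! ### Wave maps and the scattering map -/

theorem HasAsymptotics.unique {n : ℕ} {l : Filter ℝ} [l.NeBot] {q : ℝ → TodaState n}
    {a a' : AsymptoticData n} (h : HasAsymptotics l q a) (h' : HasAsymptotics l q a') : a = a' := by
  have h1 : ∀ k, a.1 k = a'.1 k := fun k => tendsto_nhds_unique (h k).2 (h' k).2
  refine Prod.ext (funext h1) (funext fun k => ?_)
  have h2 := (h k).1.sub (h' k).1
  have h3 : Tendsto (fun _ : ℝ => a'.2 k - a.2 k) l (𝓝 (0 - 0)) := by
    refine h2.congr fun t => ?_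
    rw [h1 k]; ring
  have := tendsto_nhds_unique h3 tendsto_const_nhds
  linarith

theorem prod_X_sub_C_comp_perm {n : ℕ} {A : Matrix (Fin n) (Fin n) ℝ} {lam : Fin n → ℝ}
    (h : IsOrderedSpectrum A lam) (π : Equiv.Perm (Fin n)) :
    A.charpoly = ∏ i, (Polynomial.X - Polynomial.C (lam (π i))) := by
  rw [h.2]
  exact (Equiv.prod_comp π fun i => Polynomial.X - Polynomial.C (lam i)).symm

theorem IsDiagonalization.mul_transpose {n : ℕ} {T Q : Matrix (Fin n) (Fin n) ℝ} {lam : Fin n → ℝ}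
    {π : Equiv.Perm (Fin n)} (h : IsDiagonalization T lam π Q) : Q * Qᵀ = 1 :=
  (mem_orthogonalGroup_iff _ _).1 h.1

theorem exists_isBidiagonalCoordinates {m : ℕ} (s : TodaState (m + 1)) {lam : Fin (m + 1) → ℝ}
    (h : IsOrderedSpectrum (flaschka s) lam) (π : Equiv.Perm (Fin (m + 1))) :
    ∃ β, IsBidiagonalCoordinates (flaschka s) lam π β := by
  obtain ⟨Q, L, U, hQ, hJQ, hLU⟩ := (isJacobi_flaschka s).exists_isPositiveLU
    (h.1.injective.comp π.injective) (prod_X_sub_C_comp_perm h π)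
  exact ⟨_, Q, L, U, ⟨(mem_orthogonalGroup_iff _ _).2 hQ, hJQ⟩, hLU, fun _ => rfl⟩

/-- The wave map in bidiagonal coordinates, for an ordering `π` adapted to the direction `l` of
time. -/
theorem exists_isWaveMap {m : ℕ} {l : Filter ℝ} [l.NeBot] (π : Equiv.Perm (Fin (m + 1)))
    (hl : ∀ lam : Fin (m + 1) → ℝ, StrictMono lam → ∀ k i, k < i →
      Tendsto (fun t => (lam (π i) - lam (π k)) * t) l atBot) :
    ∃ W : PhaseSpace (m + 1) → AsymptoticData (m + 1), IsWaveMap l W ∧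
      ∀ (p : PhaseSpace (m + 1)) (lam : Fin (m + 1) → ℝ), IsOrderedSpectrum (flaschka p.1) lam →
        ∀ β, IsBidiagonalCoordinates (flaschka p.1) lam π β →
          (∀ i, 0 < β i) ∧ ∀ k, (W p).1 k = -2 * lam (π k) ∧ (W p).2 k = wavePhase β k := by
  have hasym : ∀ (p : PhaseSpace (m + 1)) (lam : Fin (m + 1) → ℝ),
      IsOrderedSpectrum (flaschka p.1) lam → ∀ β, IsBidiagonalCoordinates (flaschka p.1) lam π β →
      ∀ q : ℝ → TodaState (m + 1), IsTodaTrajectory q → q 0 = p.1 →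
        HasAsymptotics l q (fun k => -2 * lam (π k), fun k => wavePhase β k) := by
    rintro p lam hlam β ⟨Q, L, U, hdiag, hLU, hβ⟩ q hq h0
    rw [← h0] at hdiag hlam
    have hx : ∑ k, (q 0).1 k = 0 := by rw [h0]; exact p.2.1
    have hy : ∑ k, (q 0).2 k = 0 := by rw [h0]; exact p.2.2
    exact hq.hasAsymptotics hx hy (hlam.1.injective.comp π.injective)
      (prod_X_sub_C_comp_perm hlam π) hdiag.mul_transpose hdiag.2 hLU hβ (hl lam hlam.1)
  have hex : ∀ p : PhaseSpace (m + 1), ∃ a : AsymptoticData (m + 1),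
      ∀ q : ℝ → TodaState (m + 1), IsTodaTrajectory q → q 0 = p.1 → HasAsymptotics l q a := by
    intro p
    obtain ⟨lam, hlam⟩ := (isJacobi_flaschka p.1).exists_isOrderedSpectrum
    obtain ⟨β, hβ⟩ := exists_isBidiagonalCoordinates p.1 hlam π
    exact ⟨_, hasym p lam hlam β hβ⟩
  choose W hW using hex
  refine ⟨W, hW, fun p lam hlam β hβ => ⟨?_, ?_⟩⟩
  · obtain ⟨Q, L, U, hdiag, hLU, hβ⟩ := hβ
    intro i
    rw [hβ]
    exact hLU.bidiagonal_pos (isJacobi_flaschka p.1) hdiag.mul_transpose hdiag.2 i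
  · obtain ⟨q, ⟨hq, h0⟩, -⟩ := existsUnique_isTodaTrajectory p.1
    have h1 := (hW p q hq h0).unique (hasym p lam hlam β hβ q hq h0)
    intro k
    rw [h1]
    exact ⟨rfl, rfl⟩

theorem proposition5p2 (n : ℕ) :
    -- every initial condition starts exactly one trajectory, and it is defined for all times
    (∀ p : PhaseSpace n, ∃! q : ℝ → TodaState n, IsTodaTrajectory q ∧ q 0 = p.1) ∧
    -- the wave maps exist
    ∃ Wm Wp : PhaseSpace n → AsymptoticData n, IsWaveMap atBot Wm ∧ IsWaveMap atTop Wp ∧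
      -- the wave maps in bidiagonal coordinates
      (∀ p : PhaseSpace n,
        (∃ lam : Fin n → ℝ, IsOrderedSpectrum (flaschka p.1) lam) ∧
        ∀ lam : Fin n → ℝ, IsOrderedSpectrum (flaschka p.1) lam →
          ((∃ β, IsBidiagonalCoordinates (flaschka p.1) lam 1 β) ∧
            ∀ β, IsBidiagonalCoordinates (flaschka p.1) lam 1 β →
              (∀ i, 0 < β i) ∧
              ∀ k : Fin n, (Wm p).1 k = -2 * lam k ∧ (Wm p).2 k = wavePhase β k) ∧
          ((∃ β, IsBidiagonalCoordinates (flaschka p.1) lam Fin.revPerm β) ∧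
            ∀ β, IsBidiagonalCoordinates (flaschka p.1) lam Fin.revPerm β →
              (∀ i, 0 < β i) ∧
              ∀ k : Fin n, (Wp p).1 k = -2 * lam k.rev ∧ (Wp p).2 k = wavePhase β k)) ∧
      -- the scattering map
      ∃ S : Set.range Wm → AsymptoticData n,
        (∀ p : PhaseSpace n, S ⟨Wm p, Set.mem_range_self p⟩ = Wp p) ∧
        ∀ (a : Set.range Wm) (k : Fin n),
          (S a).1 k.rev = a.1.1 k ∧
          (S a).2 k.rev = a.1.2 k
            + 2 * ∑ j : Fin n with j < k, Real.log |a.1.1 j - a.1.1 k|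
            - 2 * ∑ j : Fin n with k < j, Real.log |a.1.1 j - a.1.1 k| := by
  refine ⟨fun p => existsUnique_isTodaTrajectory p.1, ?_⟩
  -- Without particles every index set is empty; the theory above needs a first particle.
  rcases n with _ | m
  · have hβ : ∀ (s : TodaState 0) (lam : Fin 0 → ℝ) (π : Equiv.Perm (Fin 0)),
        ∃ β, IsBidiagonalCoordinates (flaschka s) lam π β := fun s lam π =>
      ⟨fun i => i.elim0, 1, 1, 1, ⟨one_mem _, Subsingleton.elim _ _⟩,
        ⟨fun i => i.elim0, fun i => i.elim0, fun i => i.elim0, fun i => i.elim0,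
          Subsingleton.elim _ _⟩, fun i => i.elim0⟩
    exact ⟨fun _ => (0, 0), fun _ => (0, 0), fun _ _ _ _ k => k.elim0, fun _ _ _ _ k => k.elim0,
      fun p => ⟨⟨0, fun i => i.elim0, by simp [charpoly]⟩, fun lam _ =>
        ⟨⟨hβ _ _ _, fun β _ => ⟨fun i => i.elim0, fun k => k.elim0⟩⟩,
          ⟨hβ _ _ _, fun β _ => ⟨fun i => i.elim0, fun k => k.elim0⟩⟩⟩⟩,
      fun _ => (0, 0), fun _ => rfl, fun _ k => k.elim0⟩
  obtain ⟨Wm, hWm, hm⟩ := exists_isWaveMap (l := atBot) (1 : Equiv.Perm (Fin (m + 1)))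
    fun lam hlam k i hki => tendsto_id.const_mul_atBot (sub_pos.2 (hlam hki))
  obtain ⟨Wp, hWp, hp⟩ := exists_isWaveMap (l := atTop) (Fin.revPerm : Equiv.Perm (Fin (m + 1)))
    fun lam hlam k i hki => tendsto_id.const_mul_atTop_of_neg
      (sub_neg.2 (hlam (Fin.rev_lt_rev.2 hki)))
  refine ⟨Wm, Wp, hWm, hWp, fun p => ⟨(isJacobi_flaschka p.1).exists_isOrderedSpectrum,
    fun lam hlam => ⟨⟨exists_isBidiagonalCoordinates p.1 hlam 1, hm p lam hlam⟩,
      ⟨exists_isBidiagonalCoordinates p.1 hlam Fin.revPerm, hp p lam hlam⟩⟩⟩,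
    -- The scattering map is defined by its formula, re-indexed by `k.rev`, so it is well defined
    -- from the start and only `S ∘ Wm = Wp` needs proof.
    fun a => (fun k => a.1.1 k.rev, fun k => a.1.2 k.rev
      + 2 * ∑ j with j < k.rev, Real.log |a.1.1 j - a.1.1 k.rev|
      - 2 * ∑ j with k.rev < j, Real.log |a.1.1 j - a.1.1 k.rev|), fun p => ?_, fun a k => ?_⟩
  · obtain ⟨lam, hlam⟩ := (isJacobi_flaschka p.1).exists_isOrderedSpectrum
    obtain ⟨β, hβ⟩ := exists_isBidiagonalCoordinates p.1 hlam 1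
    obtain ⟨β', hβ'⟩ := exists_isBidiagonalCoordinates p.1 hlam Fin.revPerm
    have h1 := (hm p lam hlam β hβ).2
    have h2 := (hp p lam hlam β' hβ').2
    obtain ⟨Q, L, U, hdiag, hLU, hβ⟩ := hβ
    obtain ⟨Q', L', U', hdiag', hLU', hβ'⟩ := hβ'
    refine Prod.ext (funext fun k => ?_) (funext fun k => ?_)
    · exact (h1 k.rev).1.trans (h2 k).1.symm
    · have h3 := wavePhase_rev hlam.1.injective hLU hLU' hdiag.mul_transpose hdiag'.mul_transpose
        hdiag.2 hdiag'.2 hβ hβ' k.rev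
      rw [Fin.rev_rev] at h3
      dsimp only
      rw [(h2 k).2, h3, (h1 k.rev).2]
      simp only [(h1 _).1, Equiv.Perm.one_apply]
  · simp only [Fin.rev_rev, and_self]
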